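/- **Setting.** Let $n\ge 1$ and $\kappa>1$. Points of $\mathbb R^{n+1}$ are written $X=(x,x_{n+1})$, and $|\cdot|$ is the Euclidean norm. Put $c(X,Y)=\kappa(y_{n+1}-x_{n+1})-|X-Y|$, $$\phi_{Y,b}(x)=y_{n+1}-\frac{\kappa b}{\kappa^2-1}-\sqrt{\frac{b^2}{(\kappa^2-1)^2}+\frac{|x-y|^2}{\kappa^2-1}},\qquad \phi(x,Y,X_0)=\phi_{Y,c(X_0,Y)}(x),$$ and $\Lambda(v)=(Q(v)v,\ \kappa-Q(v))$ with $Q(v)=\dfrac{\kappa-\sqrt{1-(\kappa^2-1)|v|^2}}{1+|v|^2}$ for $v\in\mathbb R^n$. Let $\Omega\subset\mathbb R^n$ be open, bounded and convex, let $\Sigma\subset\mathbb R^{n+1}$ be compact, and let $\Delta=\max_{Y\in\Sigma}\operatorname{diam}(\Omega\cup\{y\})$. Let $0<\tau_0<\tau_1$ and $\omega>0$ satisfy $\Sigma\subset\mathbb R^n\times[\tau_1,\tau_1+\omega]$, $\tau_1>\Delta/\sqrt{\kappa^2-1}$ and $\tau_1\ge\max\{\kappa\tau_0,\ \tau_0+\kappa\Delta/(\kappa-1)\}$.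 Put $\mathcal C_\Omega=\Omega\times[0,\tau_0]$. Assume that $\frac{y_{n+1}-x_{n+1}}{|Y-X|}\ge\frac1\kappa$ for all $X\in\mathcal C_\Omega$, $Y\in\Sigma$ (no total reflection), and that for each $X\in\mathcal C_\Omega$ there is a Lipschitz function $s_X$ of the unit vector $\Lambda$ such that every $Y\in\Sigma$ has the form $Y=X+s_X(\Lambda)\Lambda$ with $|\Lambda|=1$ and $s_X(\Lambda)>0$. A *parallel refractor* is a function $u:\Omega\to(0,\tau_0]$ such that for each $x_0\in\Omega$ there are $Y\in\Sigma$ and $0<b<\kappa y_{n+1}-\sqrt{y_{n+1}^2+\Delta^2}$ with $u\ge\phi_{Y,b}$ on $\Omega$ and $u(x_0)=\phi_{Y,b}(x_0)$. Its normal map is $$F_u(x_0)=\{Y\in\Sigma:\ u(x)\ge\phi(x,Y,(x_0,u(x_0)))\ \ \forall x\in\Omega\},\qquad F_u(B)=\bigcup_{x\in B}F_u(x).$$ For $\bar Y,\hat Y\in\Sigma$ and $Z=(z,z_{n+1})\in\mathcal C_\Omega$ let $v(\lambda)=(1-\lambda)D_x\phi(z,\bar Y,Z)+\lambda D_x\phi(z,\hat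 Y,Z)$ for $\lambda\in[0,1]$, and let $Y_Z(\lambda)$ be the (at most one) point of $\Sigma$ on the ray $\{Z+s\Lambda(v(\lambda)):s>0\}$. The set of these points is the refractor segment $[\bar Y,\hat Y]_Z$. The target $\Sigma$ is *regular from* $X^*\in\mathcal C_\Omega$ if there are a neighbourhood $U$ of $X^*$ and constants $c_1,c_2>0$ such that for all $\bar Y,\hat Y\in\Sigma$, $Z\in U\cap\mathcal C_\Omega$ and $\lambda\in[\frac14,\frac34]$, the point $Y_Z(\lambda)$ exists and $$\phi(x,Y_Z(\lambda),Z)\le\max\{\phi(x,\bar Y,Z),\phi(x,\hat Y,Z)\}-c_1|\bar Y-\hat Y|^2|x-z|^2\qquad\text{for all }x\in\Omega,\ |x-z|\le c_2 .$$ **Theorem.** There is a positive function $M=M(C,C_1)$ of two positive variables such that the following holds in every such setting. There is a constant $C>0$, depending only on the setting, and for every $X^*=(x^*,x^*_{n+1})\in\mathcal C_\Omega$ from which $\Sigma$ is regular there are constants $\delta,C_1,C_2>0$, depending on $X^*$, with $B_\delta(x^*)\subset\Omega$, such that for every parallel refractor $u$ with $u(x^*)=x^*_{n+1}$: 1. If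 $\bar x,\hat x\in B_\delta(x^*)$, $\bar Y\in F_u(\bar x)$, $\hat Y\in F_u(\hat x)$ and $|\bar Y-\hat Y|\ge|\bar x-\hat x|$, then there is $x_0\in[\bar x,\hat x]$ such that, with $X_0^*=(x_0,u(x_0))$, $$u(x)-\phi(x,Y,X_0^*)\ge -C|\bar Y-\hat Y||\bar x-\hat x|-C|Y(\lambda)-Y||x-x_0|+C_1|\bar Y-\hat Y|^2|x-x_0|^2$$ for all $Y(\lambda)\in[\bar Y,\hat Y]_{X_0^*}$ with $\lambda\in[\frac14,\frac34]$, all $Y\in\Sigma$ and all $x\in\Omega\cap B_{C_2}(x_0)$. 2. Let $M=M(C,C_1)$. If $\bar x,\hat x\in B_{\delta/2}(x^*)$, $\bar Y\in F_u(\bar x)$ and $\hat Y\in F_u(\hat x)$ satisfy $$|\bar Y-\hat Y|\ge\max\Big\{1,\Big(\frac{2M}{\delta}\Big)^2,\Big(\frac{2M}{C_2}\Big)^2\Big\}|\bar x-\hat x| ,$$ then there is $x_0\in[\bar x,\hat x]$ such that, with $X_0^*=(x_0,u(x_0))$, $$\mathcal N_\mu\Big(\big\{Y(\lambda)\in[\bar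 Y,\hat Y]_{X_0^*}:\lambda\in[\tfrac14,\tfrac34]\big\}\Big)\cap\Sigma\ \subset\ F_u(B_\eta(x_0)),$$ where $\mathcal N_\mu$ is the open $\mu$-neighbourhood, $\mu=|\bar Y-\hat Y|^{3/2}|\bar x-\hat x|^{1/2}$ and $\eta=M\big(|\bar x-\hat x|/|\bar Y-\hat Y|\big)^{1/2}$ (read as $\eta=0$ if $\bar Y=\hat Y$, in which case $\bar x=\hat x$ and $\mu=0$). -/

import Mathlib

noncomputable section

namespace ParallelRefractor

/-- The space `ℝⁿ` of the source. -/
abbrev Src (n : ℕ) : Type := EuclideanSpace ℝ (Fin n)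

/-- `ℝⁿ⁺¹ = ℝⁿ × ℝ` with its Euclidean norm; a point is `X = (X.fst, X.snd) = (x, x_{n+1})`. -/
abbrev Pt (n : ℕ) : Type := WithLp 2 (Src n × ℝ)

/-- The point `(x, t)` of `ℝⁿ⁺¹`. -/
def pt {n : ℕ} (x : Src n) (t : ℝ) : Pt n := WithLp.toLp 2 (x, t)

/-- `c(X, Y) = κ (y_{n+1} - x_{n+1}) - |X - Y|`. -/
def c {n : ℕ} (κ : ℝ) (X Y : Pt n) : ℝ := κ * (Y.snd - X.snd) - ‖X - Y‖

/-- `φ_{Y,b}`: its graph is the lower sheet of the hyperboloid of eccentricity `κ` with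
upper focus `Y` and parameter `b`. -/
def phiB {n : ℕ} (κ : ℝ) (Y : Pt n) (b : ℝ) (x : Src n) : ℝ :=
  Y.snd - κ * b / (κ ^ 2 - 1)
    - Real.sqrt ((b / (κ ^ 2 - 1)) ^ 2 + ‖x - Y.fst‖ ^ 2 / (κ ^ 2 - 1))

/-- `φ(x, Y, X₀)`: the hyperboloid with upper focus `Y` that passes through `X₀`. -/
def phi {n : ℕ} (κ : ℝ) (x : Src n) (Y X₀ : Pt n) : ℝ := phiB κ Y (c κ X₀ Y) x

/-- The normalisation `Q(v)` in the refracted direction `Λ(v)`. -/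
def Q {n : ℕ} (κ : ℝ) (v : Src n) : ℝ :=
  (κ - Real.sqrt (1 - (κ ^ 2 - 1) * ‖v‖ ^ 2)) / (1 + ‖v‖ ^ 2)

/-- `Λ(v) = (Q(v) v, κ - Q(v))`: the direction into which Snell's law refracts the vertical ray
`e_{n+1}` at a hyperplane with upper normal `(-v, 1)`. -/
def Lam {n : ℕ} (κ : ℝ) (v : Src n) : Pt n := pt (Q κ v • v) (κ - Q κ v)

/-- `D_xφ(x₀, Y, X₀)`, where `X₀ = (x₀, x⁰_{n+1})`. -/
def slope {n : ℕ} (κ : ℝ) (X₀ Y : Pt n) : Src n :=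
  gradient (fun x => phi κ x Y X₀) X₀.fst

/-- `v(t) = (1 - t) v̄ + t v̂`, where `v̄`, `v̂` are the slopes at `X₀` of the hyperboloids through
`X₀` with upper foci `Ybar`, `Yhat`. -/
def vAt {n : ℕ} (κ : ℝ) (X₀ Ybar Yhat : Pt n) (t : ℝ) : Src n :=
  (1 - t) • slope κ X₀ Ybar + t • slope κ X₀ Yhat

/-- The points `Y(t)` of the refractor segment `[Ybar, Yhat]_{X₀}` with parameter `t`: the points
in which the ray from `X₀` in the direction `Λ(v(t))` meets the target. -/
def segPts {n : ℕ} (κ : ℝ) (target : Set (Pt n)) (X₀ Ybar Yhat : Pt n) (t : ℝ) : Set (Pt n) :=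
  {Y | Y ∈ target ∧ ∃ s : ℝ, 0 < s ∧ Y = X₀ + s • Lam κ (vAt κ X₀ Ybar Yhat t)}

/-- The middle half `{Y(t) ∈ [Ybar, Yhat]_{X₀} : t ∈ [1/4, 3/4]}` of the refractor segment. -/
def midHalf {n : ℕ} (κ : ℝ) (target : Set (Pt n)) (X₀ Ybar Yhat : Pt n) : Set (Pt n) :=
  ⋃ t ∈ Set.Icc (1 / 4 : ℝ) (3 / 4), segPts κ target X₀ Ybar Yhat t

/-- `Δ = max { diam (Ω ∪ {y}) : (y, y_{n+1}) ∈ target }`. -/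
def bigDelta {n : ℕ} (Ω : Set (Src n)) (target : Set (Pt n)) : ℝ :=
  sSup ((fun Y : Pt n => Metric.diam (insert Y.fst Ω)) '' target)

/-- The cylinder `C_Ω = Ω × [0, τ₀]`. -/
def cyl {n : ℕ} (Ω : Set (Src n)) (τ₀ : ℝ) : Set (Pt n) :=
  {X | X.fst ∈ Ω ∧ X.snd ∈ Set.Icc 0 τ₀}

/-- The standing assumptions on the refractive index `κ`, the source `Ω` and the target. -/
structure Config {n : ℕ} (κ τ₀ τ₁ ω : ℝ) (Ω : Set (Src n)) (target : Set (Pt n)) : Prop where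
  one_lt_kappa : 1 < κ
  isOpen_source : IsOpen Ω
  convex_source : Convex ℝ Ω
  isBounded_source : Bornology.IsBounded Ω
  isCompact_target : IsCompact target
  tau_zero_pos : 0 < τ₀
  tau_zero_lt : τ₀ < τ₁
  width_pos : 0 < ω
  target_slab : ∀ Y ∈ target, Y.snd ∈ Set.Icc τ₁ (τ₁ + ω)
  height : bigDelta Ω target / Real.sqrt (κ ^ 2 - 1) < τ₁
  compat_mul : κ * τ₀ ≤ τ₁
  compat_add : τ₀ + κ * bigDelta Ω target / (κ - 1) ≤ τ₁
  /-- There is no total internal reflection. -/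
  no_total_reflection : ∀ X ∈ cyl Ω τ₀, ∀ Y ∈ target, 1 / κ ≤ (Y.snd - X.snd) / ‖Y - X‖
  /-- Seen from any point `X` of the cylinder, the target is a Lipschitz radial graph
  `Y = X + s_X(Λ) Λ`. -/
  radial_graph : ∀ X ∈ cyl Ω τ₀, ∃ (s : Pt n → ℝ) (K : NNReal),
    LipschitzOnWith K s (Metric.sphere 0 1) ∧
      ∀ Y ∈ target, ∃ L : Pt n, ‖L‖ = 1 ∧ 0 < s L ∧ Y = X + s L • L

/-- `u` is a parallel refractor from `Ω` to the target, with graph in the cylinder `C_Ω`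
(only the values of `u` on `Ω` matter). -/
structure IsRefractor {n : ℕ} (κ τ₀ : ℝ) (Ω : Set (Src n)) (target : Set (Pt n))
    (u : Src n → ℝ) : Prop where
  pos : ∀ x ∈ Ω, 0 < u x
  le_tau : ∀ x ∈ Ω, u x ≤ τ₀
  support : ∀ x₀ ∈ Ω, ∃ Y ∈ target, ∃ b : ℝ,
    0 < b ∧ b < κ * Y.snd - Real.sqrt (Y.snd ^ 2 + bigDelta Ω target ^ 2) ∧
      (∀ x ∈ Ω, phiB κ Y b x ≤ u x) ∧ u x₀ = phiB κ Y b x₀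

/-- The refractor normal map `F_u(x₀)`. -/
def normalMap {n : ℕ} (κ : ℝ) (Ω : Set (Src n)) (target : Set (Pt n)) (u : Src n → ℝ)
    (x₀ : Src n) : Set (Pt n) :=
  {Y | Y ∈ target ∧ ∀ x ∈ Ω, phi κ x Y (pt x₀ (u x₀)) ≤ u x}

/-- The target is regular from `X₀ ∈ C_Ω`: for `Z ∈ C_Ω` near `X₀`, all `Ybar`, `Yhat` in the
target and all `t ∈ [1/4, 3/4]`, the point `Y_Z(t)` of the target exists and satisfies the
strengthened maximum principle. -/
def RegularFrom {n : ℕ} (κ τ₀ : ℝ) (Ω : Set (Src n)) (target : Set (Pt n)) (X₀ : Pt n) : Prop :=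
  ∃ U ∈ nhds X₀, ∃ C₁ > 0, ∃ C₂ > 0,
    ∀ Ybar ∈ target, ∀ Yhat ∈ target, ∀ Z ∈ U ∩ cyl Ω τ₀, ∀ t ∈ Set.Icc (1 / 4 : ℝ) (3 / 4),
      ∃ Y ∈ segPts κ target Z Ybar Yhat t, ∀ x ∈ Ω, ‖x - Z.fst‖ ≤ C₂ →
        phi κ x Y Z ≤ max (phi κ x Ybar Z) (phi κ x Yhat Z)
          - C₁ * ‖Ybar - Yhat‖ ^ 2 * ‖x - Z.fst‖ ^ 2

/-- The quadratic lower bound near `xs`, with constants `δ, C, C₁, C₂`: if `x̄, x̂ ∈ B_δ(xs)`,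
`Ȳ ∈ F_u(x̄)`, `Ŷ ∈ F_u(x̂)` and `|x̄ - x̂| ≤ |Ȳ - Ŷ|`, then for some `x₀ ∈ [x̄, x̂]`, with
`X₀ = (x₀, u(x₀))`,
`u(x) - φ(x,Y,X₀) ≥ -C |Ȳ-Ŷ| |x̄-x̂| - C |Y(t)-Y| |x-x₀| + C₁ |Ȳ-Ŷ|² |x-x₀|²`
for all `Y(t)` in the middle half of `[Ȳ, Ŷ]_{X₀}`, `Y` in the target and `x ∈ Ω ∩ B_{C₂}(x₀)`. -/
def QuadraticBound {n : ℕ} (κ : ℝ) (Ω : Set (Src n)) (target : Set (Pt n)) (u : Src n → ℝ)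
    (xs : Src n) (δ C C₁ C₂ : ℝ) : Prop :=
  ∀ xbar ∈ Metric.ball xs δ, ∀ xhat ∈ Metric.ball xs δ,
    ∀ Ybar ∈ normalMap κ Ω target u xbar, ∀ Yhat ∈ normalMap κ Ω target u xhat,
      ‖xbar - xhat‖ ≤ ‖Ybar - Yhat‖ →
        ∃ x₀ ∈ segment ℝ xbar xhat,
          ∀ Yt ∈ midHalf κ target (pt x₀ (u x₀)) Ybar Yhat, ∀ Y ∈ target,
            ∀ x ∈ Ω ∩ Metric.ball x₀ C₂,
              -C * ‖Ybar - Yhat‖ * ‖xbar - xhat‖ - C * ‖Yt - Y‖ * ‖x - x₀‖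
                  + C₁ * ‖Ybar - Yhat‖ ^ 2 * ‖x - x₀‖ ^ 2
                ≤ u x - phi κ x Y (pt x₀ (u x₀))

end ParallelRefractor

end

namespace ParallelRefractor

open scoped RealInnerProductSpace
open Filter Topology

/-! ### Increments and semiconcavity of a Hilbert norm -/

section NormLemmas

variable {E : Type*} [NormedAddCommGroup E] [InnerProductSpace ℝ E]

/-! Each hyperboloid is `φ = const - ‖hv‖` with `hv` affine in `x` and `‖hv‖ ≥ b / (κ² - 1)`. Since
`c` is at least a constant `beta > 0` on the cylinder times the target (`Config.beta_le_c`),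
estimates for `φ` reduce to estimates for a norm away from the origin: `φ` is concave with bounded
second differences, and its slope is Lipschitz in the focus.

Part 1. The hyperboloids supporting `u` at `x̄` and `x̂` cross at some `x₀` in the segment, and
`u(x₀)` exceeds the crossing value by `O(|Ȳ - Ŷ||x̄ - x̂|)` (`IsRefractor.sub_crossing_le`). Raising
both to pass through `(x₀, u(x₀))` costs the same order, so their maximum is at most `u` plus that
error. The gain from regularity, and the exchange of `Y(λ)` for `Y`, give the bound
(`IsRefractor.exists_lower_bound`).

Part 2. Away from `x₀` the quadratic term beats both errors, so the hyperboloid with focus `Y`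
through `(x₀, u(x₀))` lies below `u` there. Lowering it until it supports `u` produces a contact
point in a small ball (`IsRefractor.exists_mem_normalMap`).

The obstacle is that `F_u` demands an inequality on all of `Ω`, while regularity speaks only of `x`
near `z`. For `n ≥ 2`, put `σ = ‖hv‖` at `z`. The graph of `φ(·, Y, Z)` lies on a quadric with
linear part given by the slope and quadratic part `1 / (2σ)` times a fixed Lorentz form
(`quadric_identity`). Two such graphs meet again arbitrarily close to `Z`; testing the local
principle there shows that `1 / (2σ)` is strictly concave along the segment of slopes, and this
concavity gives the principle on all of `Ω`. For `n = 1` there are no such meeting points, but two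
hyperboloids with different foci can cross only in one direction inside the cylinder, so local
support is already global (`IsRefractor.le_of_local_support`). -/

theorem norm_add_sub_norm_mul (a h : E) :
    (‖a + h‖ - ‖a‖) * (‖a + h‖ + ‖a‖) = ⟪(2 : ℝ) • a + h, h⟫ := by
  have h1 := norm_add_sq_real a h
  rw [inner_add_left, real_inner_smul_left, real_inner_self_eq_norm_sq]
  linarith

/-- The increments of the norm in a direction `h` depend on the base point in a Lipschitz way. -/
theorem abs_norm_increment_sub_le {m : ℝ} (hm : 0 < m) {a a' h : E} (h1 : m ≤ ‖a‖)
    (h2 : m ≤ ‖a + h‖) :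
    |(‖a + h‖ - ‖a‖) - (‖a' + h‖ - ‖a'‖)| ≤ 2 * ‖a - a'‖ * ‖h‖ / m := by
  have hD : 2 * m ≤ ‖a + h‖ + ‖a‖ := by linarith
  have e1 := norm_add_sub_norm_mul a h
  have e2 := norm_add_sub_norm_mul a' h
  have e3 : ⟪(2 : ℝ) • a + h, h⟫ - ⟪(2 : ℝ) • a' + h, h⟫ = 2 * ⟪a - a', h⟫ := by
    simp only [inner_add_left, real_inner_smul_left, inner_sub_left]; ring
  have e4 : |⟪a - a', h⟫| ≤ ‖a - a'‖ * ‖h‖ := abs_real_inner_le_norm _ _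
  have e5 : |‖a' + h‖ - ‖a'‖| ≤ ‖h‖ := by
    simpa using abs_norm_sub_norm_le (a' + h) a'
  have e6 : |‖a + h‖ - ‖a' + h‖| ≤ ‖a - a'‖ := by
    simpa using abs_norm_sub_norm_le (a + h) (a' + h)
  have e7 : |‖a‖ - ‖a'‖| ≤ ‖a - a'‖ := abs_norm_sub_norm_le a a'
  set A := ‖a + h‖ - ‖a‖
  set A' := ‖a' + h‖ - ‖a'‖
  set D := ‖a + h‖ + ‖a‖ with hDdef
  have key : (A - A') * D = 2 * ⟪a - a', h⟫
      - A' * ((‖a + h‖ - ‖a' + h‖) + (‖a‖ - ‖a'‖)) := by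
    rw [← e3, ← e1, ← e2]; ring
  have hb : |A - A'| * D ≤ 4 * (‖a - a'‖ * ‖h‖) := by
    have hD0 : 0 ≤ D := by linarith
    rw [← abs_of_nonneg hD0, ← abs_mul, key]
    have t1 : |2 * ⟪a - a', h⟫| ≤ 2 * (‖a - a'‖ * ‖h‖) := by
      rw [abs_mul, abs_two]; linarith
    have t2 : |A' * ((‖a + h‖ - ‖a' + h‖) + (‖a‖ - ‖a'‖))| ≤ ‖h‖ * (2 * ‖a - a'‖) := by
      rw [abs_mul]
      apply mul_le_mul e5 _ (abs_nonneg _) (norm_nonneg _)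
      exact (abs_add_le _ _).trans (by linarith)
    exact (abs_sub _ _).trans (by linarith)
  rw [le_div_iff₀ hm]
  have := mul_le_mul_of_nonneg_left hD (abs_nonneg (A - A'))
  linarith

/-- Equivalent to `2‖a‖‖a + h‖ ≤ ‖a‖² + ‖a + h‖²` after expanding the last square. -/
theorem norm_add_le_taylor {a : E} (ha : 0 < ‖a‖) (h : E) :
    ‖a + h‖ ≤ ‖a‖ + ⟪a, h⟫ / ‖a‖ + ‖h‖ ^ 2 / (2 * ‖a‖) := by
  have h1 := norm_add_sq_real a h
  have e : ‖a‖ + ⟪a, h⟫ / ‖a‖ + ‖h‖ ^ 2 / (2 * ‖a‖) = (‖a‖ ^ 2 + ‖a + h‖ ^ 2) / (2 * ‖a‖) := by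
    rw [h1]; field_simp; ring
  rw [e, le_div_iff₀ (by positivity)]
  nlinarith [sq_nonneg (‖a + h‖ - ‖a‖)]

/-- The norm is semiconcave away from the origin. -/
theorem norm_convexComb_le {a k : E} (ha : 0 < ‖a‖) {t : ℝ} (ht0 : 0 ≤ t) (ht1 : t ≤ 1) :
    (1 - t) * ‖a + (-t) • k‖ + t * ‖a + (1 - t) • k‖ ≤ ‖a‖ + ‖k‖ ^ 2 / (2 * ‖a‖) := by
  have h1 := mul_le_mul_of_nonneg_left (norm_add_le_taylor ha ((-t) • k)) (sub_nonneg.2 ht1)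
  have h2 := mul_le_mul_of_nonneg_left (norm_add_le_taylor ha ((1 - t) • k)) ht0
  rw [real_inner_smul_right, norm_smul, mul_pow, Real.norm_eq_abs, sq_abs] at h1 h2
  have e : (1 - t) * (‖a‖ + -t * ⟪a, k⟫ / ‖a‖ + (-t) ^ 2 * ‖k‖ ^ 2 / (2 * ‖a‖))
      + t * (‖a‖ + (1 - t) * ⟪a, k⟫ / ‖a‖ + (1 - t) ^ 2 * ‖k‖ ^ 2 / (2 * ‖a‖))
      = ‖a‖ + (t * (1 - t)) * (‖k‖ ^ 2 / (2 * ‖a‖)) := by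
    field_simp; ring
  have h3 : (t * (1 - t)) * (‖k‖ ^ 2 / (2 * ‖a‖)) ≤ 1 * (‖k‖ ^ 2 / (2 * ‖a‖)) :=
    mul_le_mul_of_nonneg_right (by nlinarith) (by positivity)
  linarith

theorem norm_le_convexComb {a k : E} {t : ℝ} (ht0 : 0 ≤ t) (ht1 : t ≤ 1) :
    ‖a‖ ≤ (1 - t) * ‖a + (-t) • k‖ + t * ‖a + (1 - t) • k‖ := by
  have e : a = (1 - t) • (a + (-t) • k) + t • (a + (1 - t) • k) := by module
  calc ‖a‖ = ‖(1 - t) • (a + (-t) • k) + t • (a + (1 - t) • k)‖ := by rw [← e]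
    _ ≤ _ := by
      refine (norm_add_le _ _).trans ?_
      rw [norm_smul, norm_smul, Real.norm_of_nonneg ht0, Real.norm_of_nonneg (sub_nonneg.2 ht1)]

end NormLemmas

/-! ### Hyperboloids as norms of affine maps -/

section Hyperboloids

variable {n : ℕ} {κ : ℝ}

@[simp] theorem pt_fst (x : Src n) (t : ℝ) : (pt x t).fst = x := rfl
@[simp] theorem pt_snd (x : Src n) (t : ℝ) : (pt x t).snd = t := rfl

theorem pt_eta (X : Pt n) : pt X.fst X.snd = X := rfl

theorem norm_sq_pt (X : Pt n) : ‖X‖ ^ 2 = ‖X.fst‖ ^ 2 + X.snd ^ 2 := by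
  rw [WithLp.prod_norm_sq_eq_of_L2, Real.norm_eq_abs, sq_abs]

theorem norm_fst_le (X : Pt n) : ‖X.fst‖ ≤ ‖X‖ :=
  abs_le_of_sq_le_sq' (by rw [norm_sq_pt]; nlinarith) (norm_nonneg _) |>.2

theorem abs_snd_le (X : Pt n) : |X.snd| ≤ ‖X‖ := by
  apply abs_le_of_sq_le_sq _ (norm_nonneg _)
  rw [norm_sq_pt]; nlinarith [sq_nonneg ‖X.fst‖]

/-- The vector whose norm is the square root in `phiB`. -/
noncomputable def hv (κ : ℝ) (Y : Pt n) (b : ℝ) (x : Src n) : WithLp 2 (ℝ × Src n) :=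
  WithLp.toLp 2 (b / (κ ^ 2 - 1), (Real.sqrt (κ ^ 2 - 1))⁻¹ • (x - Y.fst))

theorem kpos (hκ : 1 < κ) : 0 < κ ^ 2 - 1 := by nlinarith

theorem norm_sq_hv (hκ : 1 < κ) (Y : Pt n) (b : ℝ) (x : Src n) :
    ‖hv κ Y b x‖ ^ 2 = (b / (κ ^ 2 - 1)) ^ 2 + ‖x - Y.fst‖ ^ 2 / (κ ^ 2 - 1) := by
  rw [WithLp.prod_norm_sq_eq_of_L2]
  change ‖b / (κ ^ 2 - 1)‖ ^ 2 + ‖(Real.sqrt (κ ^ 2 - 1))⁻¹ • (x - Y.fst)‖ ^ 2 = _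
  rw [norm_smul, mul_pow, Real.norm_eq_abs, Real.norm_eq_abs, sq_abs, sq_abs, inv_pow,
    Real.sq_sqrt (kpos hκ).le]
  field_simp

theorem norm_hv (hκ : 1 < κ) (Y : Pt n) (b : ℝ) (x : Src n) :
    ‖hv κ Y b x‖ = Real.sqrt ((b / (κ ^ 2 - 1)) ^ 2 + ‖x - Y.fst‖ ^ 2 / (κ ^ 2 - 1)) := by
  rw [← norm_sq_hv hκ, Real.sqrt_sq (norm_nonneg _)]

theorem phiB_eq (hκ : 1 < κ) (Y : Pt n) (b : ℝ) (x : Src n) :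
    phiB κ Y b x = Y.snd - κ * b / (κ ^ 2 - 1) - ‖hv κ Y b x‖ := by
  rw [norm_hv hκ, phiB]

theorem le_norm_hv (hκ : 1 < κ) (Y : Pt n) (b : ℝ) (x : Src n) :
    b / (κ ^ 2 - 1) ≤ ‖hv κ Y b x‖ := by
  rw [norm_hv hκ]
  apply Real.le_sqrt_of_sq_le
  have := kpos hκ
  have : 0 ≤ ‖x - Y.fst‖ ^ 2 / (κ ^ 2 - 1) := by positivity
  linarith

theorem hv_add (Y : Pt n) (b : ℝ) (x ξ : Src n) :
    hv κ Y b (x + ξ) = hv κ Y b x + WithLp.toLp 2 (0, (Real.sqrt (κ ^ 2 - 1))⁻¹ • ξ) := by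
  have e : x + ξ - Y.fst = x - Y.fst + ξ := by abel
  rw [hv, hv, e, smul_add, ← WithLp.toLp_add 2 (_, _) (_, _), Prod.mk_add_mk, add_zero]

theorem norm_shift (hκ : 1 < κ) (ξ : Src n) :
    ‖(WithLp.toLp 2 ((0 : ℝ), (Real.sqrt (κ ^ 2 - 1))⁻¹ • ξ) : WithLp 2 (ℝ × Src n))‖
      = ‖ξ‖ / Real.sqrt (κ ^ 2 - 1) := by
  have : 0 < Real.sqrt (κ ^ 2 - 1) := Real.sqrt_pos.2 (kpos hκ)
  rw [WithLp.norm_toLp_snd, norm_smul, norm_inv, Real.norm_of_nonneg this.le]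
  field_simp

theorem norm_hv_sub_le (hκ : 1 < κ) (Y Y' : Pt n) (b b' : ℝ) (x : Src n) :
    ‖hv κ Y b x - hv κ Y' b' x‖
      ≤ |b - b'| / (κ ^ 2 - 1) + ‖Y - Y'‖ / Real.sqrt (κ ^ 2 - 1) := by
  have e : hv κ Y b x - hv κ Y' b' x
      = WithLp.toLp 2 ((b - b') / (κ ^ 2 - 1), (0 : Src n))
        + WithLp.toLp 2 ((0 : ℝ), (Real.sqrt (κ ^ 2 - 1))⁻¹ • (Y' - Y).fst) := by
    rw [hv, hv, ← WithLp.toLp_sub, ← WithLp.toLp_add, Prod.mk_add_mk, Prod.mk_sub_mk, add_zero,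
      zero_add, ← smul_sub, WithLp.sub_fst]
    congr 3
    · ring
    · abel
  rw [e]
  refine (norm_add_le _ _).trans (add_le_add ?_ ?_)
  · rw [WithLp.norm_toLp_fst, Real.norm_eq_abs, abs_div, abs_of_pos (kpos hκ)]
  · rw [norm_shift hκ]
    gcongr
    rw [norm_sub_rev Y]
    exact norm_fst_le _

/-- On the hyperboloid the distance to the focus is `b / (κ² - 1) + κ S`, with `S` the square root
in `phiB`. Hence `c(·, Y)` recovers the parameter, and two hyperboloids with focus `Y` through a
common point coincide. -/
theorem c_phiB (hκ : 1 < κ) (Y : Pt n) {b : ℝ} (hb : 0 ≤ b) (x : Src n) :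
    c κ (pt x (phiB κ Y b x)) Y = b := by
  have hk := kpos hκ
  have h1 := norm_sq_hv hκ Y b x
  have h0 := norm_nonneg (hv κ Y b x)
  rw [phiB_eq hκ, c]
  set S := ‖hv κ Y b x‖
  have e : ‖pt x (Y.snd - κ * b / (κ ^ 2 - 1) - S) - Y‖ = b / (κ ^ 2 - 1) + κ * S := by
    rw [← sq_eq_sq₀ (norm_nonneg _) (by positivity), norm_sq_pt]
    simp only [WithLp.sub_fst, WithLp.sub_snd, pt_fst, pt_snd]
    have : ‖x - Y.fst‖ ^ 2 = (κ ^ 2 - 1) * S ^ 2 - (κ ^ 2 - 1) * (b / (κ ^ 2 - 1)) ^ 2 := by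
      rw [h1]; field_simp; ring
    rw [this]; field_simp; ring
  rw [e, pt_snd]; field_simp; ring

/-- `S = (κ r - h) / (κ² - 1)` at the point through which the hyperboloid passes. -/
theorem norm_hv_c (hκ : 1 < κ) (Y X : Pt n) :
    ‖hv κ Y (c κ X Y) X.fst‖ = (κ * ‖X - Y‖ - (Y.snd - X.snd)) / (κ ^ 2 - 1) := by
  have hk := kpos hκ
  have h1 : Y.snd - X.snd ≤ ‖X - Y‖ := by
    have := abs_snd_le (X - Y)
    rw [WithLp.sub_snd, abs_sub_comm] at this
    exact (le_abs_self _).trans this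
  have h2 := norm_sq_pt (X - Y)
  rw [WithLp.sub_fst, WithLp.sub_snd] at h2
  have h3 : 0 ≤ κ * ‖X - Y‖ - (Y.snd - X.snd) := by nlinarith [norm_nonneg (X - Y)]
  rw [← sq_eq_sq₀ (norm_nonneg _) (by positivity), norm_sq_hv hκ, c]
  have : ‖X.fst - Y.fst‖ ^ 2 = ‖X - Y‖ ^ 2 - (X.snd - Y.snd) ^ 2 := by linarith
  rw [this]; field_simp; ring

theorem phi_self (hκ : 1 < κ) (Y X : Pt n) : phi κ X.fst Y X = X.snd := by
  have hk := kpos hκ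
  rw [phi, phiB_eq hκ, norm_hv_c hκ, c]; field_simp; ring

theorem phi_pt_self (hκ : 1 < κ) (Y : Pt n) (x : Src n) (t : ℝ) : phi κ x Y (pt x t) = t :=
  phi_self hκ Y (pt x t)

theorem phiB_strictAnti (hκ : 1 < κ) (Y : Pt n) {b b' : ℝ} (hb : 0 ≤ b) (hbb : b < b')
    (x : Src n) : phiB κ Y b' x < phiB κ Y b x := by
  have hk := kpos hκ
  rw [phiB, phiB]
  have h1 : κ * b / (κ ^ 2 - 1) < κ * b' / (κ ^ 2 - 1) := by gcongr
  have h2 : Real.sqrt ((b / (κ ^ 2 - 1)) ^ 2 + ‖x - Y.fst‖ ^ 2 / (κ ^ 2 - 1))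
      ≤ Real.sqrt ((b' / (κ ^ 2 - 1)) ^ 2 + ‖x - Y.fst‖ ^ 2 / (κ ^ 2 - 1)) := by
    gcongr
  linarith

theorem phiB_anti (hκ : 1 < κ) (Y : Pt n) {b b' : ℝ} (hb : 0 ≤ b) (hbb : b ≤ b')
    (x : Src n) : phiB κ Y b' x ≤ phiB κ Y b x := by
  rcases hbb.eq_or_lt with rfl | h
  · exact le_rfl
  · exact (phiB_strictAnti hκ Y hb h x).le

theorem abs_phiB_sub_le (hκ : 1 < κ) (Y : Pt n) (b : ℝ) (x x' : Src n) :
    |phiB κ Y b x - phiB κ Y b x'| ≤ ‖x - x'‖ / Real.sqrt (κ ^ 2 - 1) := by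
  rw [phiB_eq hκ, phiB_eq hκ, sub_sub_sub_cancel_left, ← norm_shift hκ]
  have := hv_add (κ := κ) Y b x' (x - x')
  rw [add_sub_cancel] at this
  rw [abs_sub_comm, this]
  refine (abs_norm_sub_norm_le _ _).trans_eq ?_
  rw [add_sub_cancel_left]

theorem continuous_phiB (Y : Pt n) (b : ℝ) : Continuous (phiB κ Y b) := by
  unfold phiB
  fun_prop

theorem abs_c_sub_le_right (hκ : 1 < κ) (X Y Y' : Pt n) :
    |c κ X Y - c κ X Y'| ≤ (κ + 1) * ‖Y - Y'‖ := by
  have h1 := abs_snd_le (Y - Y')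
  have h2 := abs_norm_sub_norm_le (X - Y') (X - Y)
  rw [sub_sub_sub_cancel_left] at h2
  rw [WithLp.sub_snd] at h1
  have e : c κ X Y - c κ X Y' = κ * (Y.snd - Y'.snd) + (‖X - Y'‖ - ‖X - Y‖) := by
    simp only [c]; ring
  rw [e]
  refine (abs_add_le _ _).trans ?_
  rw [abs_mul, abs_of_pos (by linarith)]
  nlinarith

theorem abs_c_sub_le_left (hκ : 1 < κ) (X X' Y : Pt n) :
    |c κ X Y - c κ X' Y| ≤ (κ + 1) * ‖X - X'‖ := by
  have h1 := abs_snd_le (X - X')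
  have h2 := abs_norm_sub_norm_le (X' - Y) (X - Y)
  rw [sub_sub_sub_cancel_right, norm_sub_rev X' X] at h2
  rw [WithLp.sub_snd, abs_sub_comm] at h1
  have e : c κ X Y - c κ X' Y = κ * (X'.snd - X.snd) + (‖X' - Y‖ - ‖X - Y‖) := by
    simp only [c]; ring
  rw [e]
  refine (abs_add_le _ _).trans ?_
  rw [abs_mul, abs_of_pos (by linarith)]
  nlinarith

theorem abs_phiB_sub_phiB_le (hκ : 1 < κ) (Y : Pt n) (b b' : ℝ) (x : Src n) :
    |phiB κ Y b x - phiB κ Y b' x| ≤ |b - b'| / (κ - 1) := by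
  have hk := kpos hκ
  have h1 := (abs_norm_sub_norm_le (hv κ Y b' x) (hv κ Y b x)).trans (norm_hv_sub_le hκ Y Y b' b x)
  rw [sub_self, norm_zero, zero_div, add_zero, abs_sub_comm b' b] at h1
  have e : phiB κ Y b x - phiB κ Y b' x
      = (κ * (b' - b)) / (κ ^ 2 - 1) + (‖hv κ Y b' x‖ - ‖hv κ Y b x‖) := by
    rw [phiB_eq hκ, phiB_eq hκ]; ring
  rw [e]
  refine (abs_add_le _ _).trans ((add_le_add_right h1 _).trans ?_)
  rw [abs_div, abs_mul, abs_of_pos hk, abs_of_pos (by linarith : 0 < κ), abs_sub_comm b' b]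
  have h3 : 0 < κ - 1 := by linarith
  apply le_of_eq
  field_simp
  ring

/-- Changing the height of the point on the hyperboloid changes it in a Lipschitz way. -/
theorem abs_phi_sub_phi_height (hκ : 1 < κ) (Y : Pt n) (x z : Src n) (t t' : ℝ) :
    |phi κ x Y (pt z t) - phi κ x Y (pt z t')| ≤ (κ + 1) / (κ - 1) * |t - t'| := by
  have h1 := abs_phiB_sub_phiB_le hκ Y (c κ (pt z t) Y) (c κ (pt z t') Y) x
  have h2 := abs_c_sub_le_left hκ (pt z t) (pt z t') Y
  have e : ‖pt z t - pt z t'‖ = |t - t'| := by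
    rw [← sq_eq_sq₀ (norm_nonneg _) (abs_nonneg _), norm_sq_pt]
    simp
  rw [e] at h2
  have h3 : 0 < κ - 1 := by linarith
  refine h1.trans ?_
  rw [div_mul_eq_mul_div]
  gcongr

/-- The Lipschitz constant of the slope of `φ` in the focus, when `c ≥ β`. -/
noncomputable def mixedConst (κ β : ℝ) : ℝ :=
  2 * ((κ + 1) / (κ ^ 2 - 1) + 1 / Real.sqrt (κ ^ 2 - 1)) * (1 / Real.sqrt (κ ^ 2 - 1))
    / (β / (κ ^ 2 - 1))

theorem mixedConst_pos (hκ : 1 < κ) {β : ℝ} (hβ : 0 < β) : 0 < mixedConst κ β := by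
  have hk := kpos hκ
  have : 0 < Real.sqrt (κ ^ 2 - 1) := Real.sqrt_pos.2 hk
  have : 0 < κ := by linarith
  unfold mixedConst
  positivity

/-- An integrated bound on the mixed derivative in `x` and `Y`: changing the focus moves the base
vector `hv` by `O(‖Y - Y'‖)`, and norm increments are Lipschitz in the base vector. A lower bound on
the norm is needed for one focus only. -/
theorem abs_phi_increment_sub_le (hκ : 1 < κ) {β : ℝ} (hβ : 0 < β) (X Y Y' : Pt n)
    (hY : β ≤ c κ X Y) (ξ : Src n) :
    |(‖hv κ Y (c κ X Y) (X.fst + ξ)‖ - ‖hv κ Y (c κ X Y) X.fst‖)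
      - (‖hv κ Y' (c κ X Y') (X.fst + ξ)‖ - ‖hv κ Y' (c κ X Y') X.fst‖)|
      ≤ mixedConst κ β * ‖Y - Y'‖ * ‖ξ‖ := by
  have hk := kpos hκ
  have hsq : 0 < Real.sqrt (κ ^ 2 - 1) := Real.sqrt_pos.2 hk
  have hm : 0 < β / (κ ^ 2 - 1) := by positivity
  have hle : β / (κ ^ 2 - 1) ≤ c κ X Y / (κ ^ 2 - 1) := by gcongr
  have h1 := hle.trans (le_norm_hv hκ Y (c κ X Y) X.fst)
  have h2 := hle.trans (le_norm_hv hκ Y (c κ X Y) (X.fst + ξ))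
  rw [hv_add] at h2 ⊢
  rw [hv_add Y']
  refine (abs_norm_increment_sub_le hm (a' := hv κ Y' (c κ X Y') X.fst) h1 h2).trans ?_
  rw [norm_shift hκ]
  have h3 : ‖hv κ Y (c κ X Y) X.fst - hv κ Y' (c κ X Y') X.fst‖
      ≤ ((κ + 1) / (κ ^ 2 - 1) + 1 / Real.sqrt (κ ^ 2 - 1)) * ‖Y - Y'‖ := by
    refine (norm_hv_sub_le hκ Y Y' _ _ _).trans ?_
    have := abs_c_sub_le_right hκ X Y Y'
    have : |c κ X Y - c κ X Y'| / (κ ^ 2 - 1) ≤ (κ + 1) * ‖Y - Y'‖ / (κ ^ 2 - 1) := by gcongr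
    refine (add_le_add_left this _).trans (le_of_eq ?_)
    ring
  calc 2 * ‖hv κ Y (c κ X Y) X.fst - hv κ Y' (c κ X Y') X.fst‖ *
        (‖ξ‖ / Real.sqrt (κ ^ 2 - 1)) / (β / (κ ^ 2 - 1))
      ≤ 2 * (((κ + 1) / (κ ^ 2 - 1) + 1 / Real.sqrt (κ ^ 2 - 1)) * ‖Y - Y'‖) *
        (‖ξ‖ / Real.sqrt (κ ^ 2 - 1)) / (β / (κ ^ 2 - 1)) := by gcongr
    _ = _ := by unfold mixedConst; ring

theorem phi_eq_increment (hκ : 1 < κ) (Y X : Pt n) (ξ : Src n) :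
    phi κ (X.fst + ξ) Y X
      = X.snd - (‖hv κ Y (c κ X Y) (X.fst + ξ)‖ - ‖hv κ Y (c κ X Y) X.fst‖) := by
  have h := phi_self hκ Y X
  rw [phi, phiB_eq hκ] at h ⊢
  linarith

theorem abs_phi_sub_phi_le (hκ : 1 < κ) {β : ℝ} (hβ : 0 < β) (X Y Y' : Pt n)
    (hY : β ≤ c κ X Y) (x : Src n) :
    |phi κ x Y X - phi κ x Y' X| ≤ mixedConst κ β * ‖Y - Y'‖ * ‖x - X.fst‖ := by
  have h := abs_phi_increment_sub_le hκ hβ X Y Y' hY (x - X.fst)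
  have e1 := phi_eq_increment hκ Y X (x - X.fst)
  have e2 := phi_eq_increment hκ Y' X (x - X.fst)
  rw [abs_sub_comm] at h
  rw [add_sub_cancel] at h e1 e2
  rw [e1, e2, sub_sub_sub_cancel_left]
  rwa [abs_sub_comm] at h ⊢

end Hyperboloids

/-! ### Uniform bounds in the setting, crossing points and the lower bound for `u` -/

section Setting

variable {n : ℕ} {κ τ₀ τ₁ ω : ℝ} {Ω : Set (Src n)} {target : Set (Pt n)}

/-- A positive lower bound for `c` on the cylinder times the target. -/
noncomputable def beta (κ τ₀ τ₁ : ℝ) : ℝ := (κ - 1) ^ 2 * (τ₁ - τ₀) / κ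

theorem Config.beta_pos (h : Config κ τ₀ τ₁ ω Ω target) : 0 < beta κ τ₀ τ₁ := by
  have h1 := h.one_lt_kappa
  have h2 := h.tau_zero_lt
  have : 0 < κ - 1 := by linarith
  have : 0 < τ₁ - τ₀ := by linarith
  have : 0 < κ := by linarith
  unfold beta
  positivity

theorem Config.norm_sub_fst_le (h : Config κ τ₀ τ₁ ω Ω target) {x : Src n} (hx : x ∈ Ω)
    {Y : Pt n} (hY : Y ∈ target) : ‖x - Y.fst‖ ≤ bigDelta Ω target := by
  have hb : ∀ Y : Pt n, Bornology.IsBounded (insert Y.fst Ω) := fun Y =>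
    h.isBounded_source.insert _
  have h1 : ‖x - Y.fst‖ ≤ Metric.diam (insert Y.fst Ω) := by
    rw [← dist_eq_norm]
    exact Metric.dist_le_diam_of_mem (hb Y) (Set.mem_insert_of_mem _ hx) (Set.mem_insert _ _)
  refine h1.trans (le_csSup ?_ ⟨Y, hY, rfl⟩)
  obtain ⟨R, hR⟩ := h.isBounded_source.exists_norm_le
  obtain ⟨R', hR'⟩ := h.isCompact_target.isBounded.exists_norm_le
  have hR0 : 0 ≤ max R R' := (norm_nonneg x).trans ((hR x hx).trans (le_max_left _ _))
  refine ⟨2 * max R R', ?_⟩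
  rintro _ ⟨Z, hZ, rfl⟩
  apply Metric.diam_le_of_subset_closedBall (x := (0 : Src n)) hR0
  rintro w (rfl | hw)
  · rw [mem_closedBall_zero_iff]
    exact (norm_fst_le Z).trans ((hR' Z hZ).trans (le_max_right _ _))
  · rw [mem_closedBall_zero_iff]
    exact (hR w hw).trans (le_max_left _ _)

/-- With `h = y_{n+1} - x_{n+1}`, the triangle inequality gives `c ≥ (κ - 1) h - |x - y|`, and
`compat_add` gives `|x - y| ≤ (κ - 1) h / κ`. What remains is `(κ - 1)² h / κ`, with `h ≥ τ₁ - τ₀`.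
-/
theorem Config.beta_le_c (h : Config κ τ₀ τ₁ ω Ω target) {X Y : Pt n} (hX : X ∈ cyl Ω τ₀)
    (hY : Y ∈ target) : beta κ τ₀ τ₁ ≤ c κ X Y := by
  have h1 := h.one_lt_kappa
  have h0 : 0 < κ - 1 := by linarith
  have h2 := h.compat_add
  have h3 := h.norm_sub_fst_le hX.1 hY
  have h4 := (h.target_slab Y hY).1
  have h5 := hX.2.2
  have h6 := h.tau_zero_lt
  have h7 : ‖X - Y‖ ≤ ‖X.fst - Y.fst‖ + (Y.snd - X.snd) := by
    apply abs_le_of_sq_le_sq' _ (by nlinarith [norm_nonneg (X.fst - Y.fst)]) |>.2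
    rw [norm_sq_pt, WithLp.sub_fst, WithLp.sub_snd]
    nlinarith [mul_nonneg (norm_nonneg (X.fst - Y.fst)) (by linarith : 0 ≤ Y.snd - X.snd)]
  have h8 : κ * bigDelta Ω target ≤ (κ - 1) * (Y.snd - X.snd) := by
    have : κ * bigDelta Ω target / (κ - 1) ≤ Y.snd - X.snd := by linarith
    rw [div_le_iff₀ h0] at this
    linarith
  unfold beta c
  rw [div_le_iff₀ (by linarith)]
  have h9 : κ * ‖X - Y‖ ≤ κ * (‖X.fst - Y.fst‖ + (Y.snd - X.snd)) := by gcongr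
  have h10 : κ * ‖X.fst - Y.fst‖ ≤ κ * bigDelta Ω target := by gcongr
  have h11 : (κ - 1) ^ 2 * (τ₁ - τ₀) ≤ (κ - 1) ^ 2 * (Y.snd - X.snd) := by
    gcongr
  nlinarith

theorem Config.c_le (h : Config κ τ₀ τ₁ ω Ω target) {X Y : Pt n} (hX : X ∈ cyl Ω τ₀)
    (hY : Y ∈ target) : c κ X Y ≤ κ * (τ₁ + ω) := by
  have h1 := h.one_lt_kappa
  have h4 := (h.target_slab Y hY).2
  have h5 := hX.2.1
  have h6 : κ * (Y.snd - X.snd) ≤ κ * (τ₁ + ω) := by gcongr; linarith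
  unfold c
  linarith [norm_nonneg (X - Y)]

theorem Config.eq_of_ray (h : Config κ τ₀ τ₁ ω Ω target) {X : Pt n} (hX : X ∈ cyl Ω τ₀)
    {Y Y' V : Pt n} (hY : Y ∈ target) (hY' : Y' ∈ target) {r r' : ℝ} (hr : 0 < r) (hr' : 0 < r')
    (e : Y = X + r • V) (e' : Y' = X + r' • V) : Y = Y' := by
  obtain ⟨s, -, -, hs⟩ := h.radial_graph X hX
  obtain ⟨L, hL, hsL, eL⟩ := hs Y hY
  obtain ⟨L', hL', hsL', eL'⟩ := hs Y' hY'
  have h1 : s L • L = r • V := add_left_cancel (eL.symm.trans e)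
  have h2 : s L' • L' = r' • V := add_left_cancel (eL'.symm.trans e')
  have n1 : s L = r * ‖V‖ := by
    have := congrArg norm h1
    rwa [norm_smul, norm_smul, hL, mul_one, Real.norm_of_nonneg hsL.le,
      Real.norm_of_nonneg hr.le] at this
  have n2 : s L' = r' * ‖V‖ := by
    have := congrArg norm h2
    rwa [norm_smul, norm_smul, hL', mul_one, Real.norm_of_nonneg hsL'.le,
      Real.norm_of_nonneg hr'.le] at this
  have hV : 0 < ‖V‖ := by
    rcases (norm_nonneg V).eq_or_lt with h0 | h0
    · rw [← h0, mul_zero] at n1; linarith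
    · exact h0
  have l1 : L = ‖V‖⁻¹ • V := by
    have : (r * ‖V‖) • L = (r * ‖V‖) • (‖V‖⁻¹ • V) := by
      rw [← n1, h1, n1, smul_smul]; congr 1; field_simp
    exact smul_right_injective _ (by positivity : r * ‖V‖ ≠ 0) this
  have l2 : L' = ‖V‖⁻¹ • V := by
    have : (r' * ‖V‖) • L' = (r' * ‖V‖) • (‖V‖⁻¹ • V) := by
      rw [← n2, h2, n2, smul_smul]; congr 1; field_simp
    exact smul_right_injective _ (by positivity : r' * ‖V‖ ≠ 0) this
  rw [eL, eL', l1, l2]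

theorem Config.segPts_subsingleton (h : Config κ τ₀ τ₁ ω Ω target) {X : Pt n}
    (hX : X ∈ cyl Ω τ₀) (Ybar Yhat : Pt n) (t : ℝ) :
    (segPts κ target X Ybar Yhat t).Subsingleton := by
  rintro Y ⟨hY, r, hr, e⟩ Y' ⟨hY', r', hr', e'⟩
  exact h.eq_of_ray hX hY hY' hr hr' e e'

variable {u : Src n → ℝ}

theorem IsRefractor.mem_cyl (hu : IsRefractor κ τ₀ Ω target u) {x : Src n} (hx : x ∈ Ω) :
    pt x (u x) ∈ cyl Ω τ₀ := ⟨hx, (hu.pos x hx).le, hu.le_tau x hx⟩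

/-- At the contact point `b` equals `c`, so the positive lower bound for `c` on the cylinder applies
to `b`. -/
theorem IsRefractor.exists_support (h : Config κ τ₀ τ₁ ω Ω target)
    (hu : IsRefractor κ τ₀ Ω target u) {x₀ : Src n} (hx : x₀ ∈ Ω) :
    ∃ Y ∈ target, ∃ b : ℝ, beta κ τ₀ τ₁ ≤ b ∧ (∀ x ∈ Ω, phiB κ Y b x ≤ u x) ∧
      u x₀ = phiB κ Y b x₀ := by
  obtain ⟨Y, hY, b, hb, -, hle, heq⟩ := hu.support x₀ hx
  refine ⟨Y, hY, b, ?_, hle, heq⟩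
  rw [← c_phiB h.one_lt_kappa Y hb.le x₀, ← heq]
  exact h.beta_le_c (hu.mem_cyl hx) hY

theorem IsRefractor.abs_sub_le (h : Config κ τ₀ τ₁ ω Ω target)
    (hu : IsRefractor κ τ₀ Ω target u) {x x' : Src n} (hx : x ∈ Ω) (hx' : x' ∈ Ω) :
    |u x - u x'| ≤ ‖x - x'‖ / Real.sqrt (κ ^ 2 - 1) := by
  have key : ∀ x ∈ Ω, ∀ x' ∈ Ω, u x - u x' ≤ ‖x - x'‖ / Real.sqrt (κ ^ 2 - 1) := by
    intro x hx x' hx'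
    obtain ⟨Y, -, b, -, hle, heq⟩ := hu.exists_support h hx
    have h1 := (le_abs_self _).trans (abs_phiB_sub_le h.one_lt_kappa Y b x x')
    have h2 := hle x' hx'
    linarith
  rw [abs_le]
  have h1 := key x hx x' hx'
  have h2 := key x' hx' x hx
  rw [norm_sub_rev] at h2
  exact ⟨by linarith, h1⟩

theorem IsRefractor.continuousOn (h : Config κ τ₀ τ₁ ω Ω target)
    (hu : IsRefractor κ τ₀ Ω target u) : ContinuousOn u Ω := by
  have : LipschitzOnWith (Real.toNNReal (Real.sqrt (κ ^ 2 - 1))⁻¹) u Ω := by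
    apply LipschitzOnWith.of_dist_le_mul
    intro x hx y hy
    rw [Real.dist_eq, dist_eq_norm, Real.coe_toNNReal _ (by positivity)]
    refine (hu.abs_sub_le h hx hy).trans_eq ?_
    ring
  exact this.continuousOn

/-- The Lipschitz constants of the quadratic lower bound. -/
noncomputable def boundConst (κ β : ℝ) : ℝ :=
  mixedConst κ β + (κ + 1) / (κ - 1) * (mixedConst κ β + 1 / (2 * β))

theorem hv_add_smul (Y : Pt n) (b t : ℝ) (x ξ : Src n) :
    hv κ Y b (x + t • ξ)
      = hv κ Y b x + t • WithLp.toLp 2 ((0 : ℝ), (Real.sqrt (κ ^ 2 - 1))⁻¹ • ξ) := by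
  rw [hv_add, ← WithLp.toLp_smul 2 t ((0 : ℝ), _), Prod.smul_mk, smul_zero, smul_comm]

/-- Where two supporting hyperboloids cross, the refractor is close to them. -/
theorem IsRefractor.sub_crossing_le (h : Config κ τ₀ τ₁ ω Ω target)
    (hu : IsRefractor κ τ₀ Ω target u) {x₀ K : Src n} {t : ℝ} (ht0 : 0 ≤ t) (ht1 : t ≤ 1)
    (hx₀ : x₀ ∈ Ω) (hx : x₀ + (-t) • K ∈ Ω) (hx' : x₀ + (1 - t) • K ∈ Ω) {Y Y' : Pt n}
    {b b' : ℝ} (hb : beta κ τ₀ τ₁ ≤ b) (hb' : beta κ τ₀ τ₁ ≤ b')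
    (e : u (x₀ + (-t) • K) = phiB κ Y b (x₀ + (-t) • K))
    (e' : u (x₀ + (1 - t) • K) = phiB κ Y' b' (x₀ + (1 - t) • K))
    (e₀ : phiB κ Y b x₀ = phiB κ Y' b' x₀) (hK : ‖K‖ ≤ ‖Y - Y'‖) :
    u x₀ - phiB κ Y b x₀
      ≤ (mixedConst κ (beta κ τ₀ τ₁) + 1 / (2 * beta κ τ₀ τ₁)) * (‖Y - Y'‖ * ‖K‖) := by
  have hκ := h.one_lt_kappa
  have hk := kpos hκ
  have hβ := h.beta_pos
  set β := beta κ τ₀ τ₁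
  -- A third hyperboloid, supporting `u` at `x₀`, bounds `u x₀` from above: it lies below `u` at
  -- both ends, and its value at `x₀` exceeds the average of its end values by `O(‖K‖²)`.
  obtain ⟨Y₀, -, b₀, hb₀, hle, heq⟩ := hu.exists_support h hx₀
  have s1 := hle _ hx
  have s2 := hle _ hx'
  have c1 : c κ (pt x₀ (phiB κ Y b x₀)) Y = b := c_phiB hκ Y (hβ.le.trans hb) x₀
  have c2 : c κ (pt x₀ (phiB κ Y b x₀)) Y' = b' := by
    rw [e₀]; exact c_phiB hκ Y' (hβ.le.trans hb') x₀
  -- The two crossing hyperboloids share a point over `x₀`, so their increments from it are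
  -- comparable. At the far end `Y'` can be traded for `Y`, and concavity of a single hyperboloid
  -- finishes.
  have mix := abs_phi_increment_sub_le hκ hβ (pt x₀ (phiB κ Y b x₀)) Y Y' (hb.trans_eq c1.symm)
    ((1 - t) • K)
  rw [c1, c2, pt_fst, norm_smul, Real.norm_of_nonneg (sub_nonneg.2 ht1)] at mix
  have mix1 := (abs_le.1 mix).2
  have n0 : β / (κ ^ 2 - 1) ≤ ‖hv κ Y₀ b₀ x₀‖ :=
    (by gcongr : β / (κ ^ 2 - 1) ≤ b₀ / (κ ^ 2 - 1)).trans (le_norm_hv hκ _ _ _)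
  have n0' : 0 < β / (κ ^ 2 - 1) := by positivity
  have sh := norm_shift hκ K
  rw [e, phiB_eq hκ, phiB_eq hκ] at s1
  rw [e', phiB_eq hκ, phiB_eq hκ] at s2
  rw [phiB_eq hκ] at heq
  rw [phiB_eq hκ, phiB_eq hκ] at e₀
  rw [phiB_eq hκ Y]
  rw [hv_add_smul] at s1 s2 mix1
  rw [hv_add_smul] at s1 s2 mix1
  set k' : WithLp 2 (ℝ × Src n) := WithLp.toLp 2 ((0 : ℝ), (Real.sqrt (κ ^ 2 - 1))⁻¹ • K)
  have L1 := norm_convexComb_le (k := k') (n0'.trans_le n0) ht0 ht1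
  have L2 := norm_le_convexComb (a := hv κ Y b x₀) (k := k') ht0 ht1
  have s1' := mul_le_mul_of_nonneg_left s1 (sub_nonneg.2 ht1)
  have s2' := mul_le_mul_of_nonneg_left s2 ht0
  have mix2 := mul_le_mul_of_nonneg_left mix1 ht0
  have q : ‖k'‖ ^ 2 / (2 * ‖hv κ Y₀ b₀ x₀‖) ≤ 1 / (2 * β) * (‖Y - Y'‖ * ‖K‖) := by
    calc ‖k'‖ ^ 2 / (2 * ‖hv κ Y₀ b₀ x₀‖) ≤ ‖k'‖ ^ 2 / (2 * (β / (κ ^ 2 - 1))) := by gcongr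
      _ = 1 / (2 * β) * (‖K‖ * ‖K‖) := by
        rw [sh, div_pow, Real.sq_sqrt hk.le]; field_simp
      -- Here `‖K‖ ≤ ‖Y - Y'‖` turns the second-order error `‖K‖²` into the product `‖Y - Y'‖ *
      -- ‖K‖`.
      _ ≤ _ := by gcongr
  have mc := mixedConst_pos hκ hβ
  have q2 : t * (mixedConst κ β * ‖Y - Y'‖ * ((1 - t) * ‖K‖))
      ≤ mixedConst κ β * (‖Y - Y'‖ * ‖K‖) := by
    have : (t * (1 - t)) * (mixedConst κ β * (‖Y - Y'‖ * ‖K‖))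
      ≤ 1 * (mixedConst κ β * (‖Y - Y'‖ * ‖K‖)) :=
      mul_le_mul_of_nonneg_right (by nlinarith) (by positivity)
    linarith
  have e₀' := congrArg (fun r => t * r) e₀
  rw [add_mul]
  linarith

theorem exists_crossing {x x' : Src n} {Y Y' : Pt n} {b b' : ℝ}
    (h : phiB κ Y' b' x ≤ phiB κ Y b x) (h' : phiB κ Y b x' ≤ phiB κ Y' b' x') :
    ∃ t ∈ Set.Icc (0 : ℝ) 1, phiB κ Y b (x + t • (x' - x)) = phiB κ Y' b' (x + t • (x' - x)) := by
  have hc : ContinuousOn (fun t : ℝ => phiB κ Y b (x + t • (x' - x))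
      - phiB κ Y' b' (x + t • (x' - x))) (Set.Icc 0 1) := by
    have := continuous_phiB (κ := κ) Y b
    have := continuous_phiB (κ := κ) Y' b'
    fun_prop
  have := intermediate_value_Icc' zero_le_one hc
  obtain ⟨t, ht, e⟩ := this (show (0 : ℝ) ∈ _ by
    constructor
    · simp only [one_smul, add_sub_cancel]; linarith
    · simp only [zero_smul, add_zero]; linarith)
  exact ⟨t, ht, sub_eq_zero.1 e⟩

/-- A max principle with gain `G` at the crossing point turns into a lower bound for `u`. -/
theorem IsRefractor.exists_lower_bound (h : Config κ τ₀ τ₁ ω Ω target)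
    (hu : IsRefractor κ τ₀ Ω target u) {xbar xhat : Src n} (hxb : xbar ∈ Ω) (hxh : xhat ∈ Ω)
    {Ybar Yhat : Pt n} (hYb : Ybar ∈ normalMap κ Ω target u xbar)
    (hYh : Yhat ∈ normalMap κ Ω target u xhat) (hle : ‖xbar - xhat‖ ≤ ‖Ybar - Yhat‖) :
    ∃ x₀ ∈ segment ℝ xbar xhat, ∀ Yt ∈ target, ∀ Y ∈ target, ∀ x ∈ Ω, ∀ G : ℝ,
      phi κ x Yt (pt x₀ (u x₀)) ≤ max (phi κ x Ybar (pt x₀ (u x₀)))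
          (phi κ x Yhat (pt x₀ (u x₀))) - G →
        -boundConst κ (beta κ τ₀ τ₁) * ‖Ybar - Yhat‖ * ‖xbar - xhat‖
          - boundConst κ (beta κ τ₀ τ₁) * ‖Yt - Y‖ * ‖x - x₀‖ + G
          ≤ u x - phi κ x Y (pt x₀ (u x₀)) := by
  have hκ := h.one_lt_kappa
  have hβ := h.beta_pos
  have lb := h.beta_le_c (hu.mem_cyl hxb) hYb.1
  have lh := h.beta_le_c (hu.mem_cyl hxh) hYh.1
  have eb : phiB κ Ybar (c κ (pt xbar (u xbar)) Ybar) xbar = u xbar := phi_pt_self hκ _ _ _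
  have eh : phiB κ Yhat (c κ (pt xhat (u xhat)) Yhat) xhat = u xhat := phi_pt_self hκ _ _ _
  have sb : ∀ x ∈ Ω, phiB κ Ybar (c κ (pt xbar (u xbar)) Ybar) x ≤ u x := hYb.2
  have sh : ∀ x ∈ Ω, phiB κ Yhat (c κ (pt xhat (u xhat)) Yhat) x ≤ u x := hYh.2
  set bb := c κ (pt xbar (u xbar)) Ybar
  set bh := c κ (pt xhat (u xhat)) Yhat
  set β := beta κ τ₀ τ₁
  obtain ⟨t, ht, e₀⟩ := exists_crossing (κ := κ) (x := xbar) (x' := xhat) (Y := Ybar) (Y' := Yhat)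
    (b := bb) (b' := bh) (by rw [eb]; exact sh _ hxb) (by rw [eh]; exact sb _ hxh)
  set x₀ := xbar + t • (xhat - xbar) with hx₀
  have mem : x₀ ∈ segment ℝ xbar xhat := by
    rw [segment_eq_image']; exact ⟨t, ht, rfl⟩
  have hx₀Ω : x₀ ∈ Ω := h.convex_source.segment_subset hxb hxh mem
  have p1 : x₀ + (-t) • (xhat - xbar) = xbar := by rw [hx₀]; module
  have p2 : x₀ + (1 - t) • (xhat - xbar) = xhat := by rw [hx₀]; module
  have hdK : ‖xhat - xbar‖ = ‖xbar - xhat‖ := norm_sub_rev _ _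
  have cr := hu.sub_crossing_le h (K := xhat - xbar) ht.1 ht.2 hx₀Ω (p1.symm ▸ hxb)
    (p2.symm ▸ hxh) lb lh (by rw [p1, eb]) (by rw [p2, eh]) e₀ (by rwa [hdK])
  rw [hdK] at cr
  have cr0 : 0 ≤ u x₀ - phiB κ Ybar bb x₀ := sub_nonneg.2 (sb _ hx₀Ω)
  refine ⟨x₀, mem, fun Yt hYt Y hY x hx G hG => ?_⟩
  set φ₀ := phiB κ Ybar bb x₀ with hφ₀
  have cb : phi κ x Ybar (pt x₀ φ₀) = phiB κ Ybar bb x := by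
    rw [phi, c_phiB hκ Ybar (hβ.le.trans lb)]
  have ch : phi κ x Yhat (pt x₀ φ₀) = phiB κ Yhat bh x := by
    rw [phi, e₀, c_phiB hκ Yhat (hβ.le.trans lh)]
  have kk : 0 < (κ + 1) / (κ - 1) := div_pos (by linarith) (by linarith)
  -- The cost of raising both hyperboloids from the crossing height `φ₀` to `u x₀`.
  have gap : (κ + 1) / (κ - 1) * |u x₀ - φ₀| ≤ (κ + 1) / (κ - 1) *
      ((mixedConst κ β + 1 / (2 * β)) * (‖Ybar - Yhat‖ * ‖xbar - xhat‖)) := by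
    rw [abs_of_nonneg cr0]; gcongr
  have hb1 := (le_abs_self _).trans ((abs_phi_sub_phi_height hκ Ybar x x₀ (u x₀) φ₀).trans gap)
  have hh1 := (le_abs_self _).trans ((abs_phi_sub_phi_height hκ Yhat x x₀ (u x₀) φ₀).trans gap)
  rw [cb] at hb1
  rw [ch] at hh1
  have hmax : max (phi κ x Ybar (pt x₀ (u x₀))) (phi κ x Yhat (pt x₀ (u x₀)))
      ≤ u x + (κ + 1) / (κ - 1) *
        ((mixedConst κ β + 1 / (2 * β)) * (‖Ybar - Yhat‖ * ‖xbar - xhat‖)) :=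
    max_le (by linarith [sb x hx]) (by linarith [sh x hx])
  have mx := (abs_le.1 (abs_phi_sub_phi_le hκ hβ (pt x₀ (u x₀)) Yt Y
    (h.beta_le_c (hu.mem_cyl hx₀Ω) hYt) x)).1
  rw [pt_fst] at mx
  have mc := mixedConst_pos hκ hβ
  -- `boundConst` is a single constant for both error terms; `x1` and `x2` are its surplus in each.
  have x1 : 0 ≤ (κ + 1) / (κ - 1) * (mixedConst κ β + 1 / (2 * β)) * (‖Yt - Y‖ * ‖x - x₀‖) := by
    positivity
  have x2 : 0 ≤ mixedConst κ β * (‖Ybar - Yhat‖ * ‖xbar - xhat‖) := by positivity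
  unfold boundConst
  linarith

end Setting

/-! ### Slopes, refracted directions and foci -/

section Slopes

variable {n : ℕ} {κ : ℝ}

theorem hasGradientAt_phiB (hκ : 1 < κ) (Y : Pt n) {b : ℝ} (hb : 0 < b) (x : Src n) :
    HasGradientAt (phiB κ Y b) ((1 / ((κ ^ 2 - 1) * ‖hv κ Y b x‖)) • (Y.fst - x)) x := by
  have hk := kpos hκ
  have h0 : 0 < ‖hv κ Y b x‖ := (by positivity : 0 < b / (κ ^ 2 - 1)).trans_le (le_norm_hv hκ _ _ _)
  have hne : (b / (κ ^ 2 - 1)) ^ 2 + ‖x - Y.fst‖ ^ 2 / (κ ^ 2 - 1) ≠ 0 := by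
    rw [← norm_sq_hv hκ]; positivity
  rw [hasGradientAt_iff_hasFDerivAt]
  have h1 : HasFDerivAt (fun x : Src n => ‖x - Y.fst‖ ^ 2)
      (2 • innerSL ℝ (x - Y.fst)) x := by
    have := (hasStrictFDerivAt_norm_sq (x - Y.fst)).hasFDerivAt.comp x
      ((hasFDerivAt_id x).sub_const Y.fst)
    exact this
  have h2 := (((h1.mul_const (κ ^ 2 - 1)⁻¹).const_add ((b / (κ ^ 2 - 1)) ^ 2)).sqrt
    (by rwa [← div_eq_mul_inv])).const_sub (Y.snd - κ * b / (κ ^ 2 - 1))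
  have h3 : (fun x => Y.snd - κ * b / (κ ^ 2 - 1) - Real.sqrt ((b / (κ ^ 2 - 1)) ^ 2
      + ‖x - Y.fst‖ ^ 2 * (κ ^ 2 - 1)⁻¹)) = phiB κ Y b := by
    funext x; rw [phiB, div_eq_mul_inv (‖x - Y.fst‖ ^ 2)]
  rw [h3, ← div_eq_mul_inv, ← norm_hv hκ] at h2
  refine h2.congr_fderiv ?_
  ext ξ
  have e : Y.fst - x = -(x - Y.fst) := by abel
  rw [e, smul_neg]
  simp only [InnerProductSpace.toDual_apply_apply, inner_neg_left, real_inner_smul_left,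
    neg_apply, smul_apply, innerSL_apply_apply, smul_eq_mul,
    nsmul_eq_mul]
  push_cast
  field_simp

theorem slope_eq (hκ : 1 < κ) {X Y : Pt n} (hc : 0 < c κ X Y) :
    slope κ X Y = (1 / ((κ ^ 2 - 1) * ‖hv κ Y (c κ X Y) X.fst‖)) • (Y.fst - X.fst) :=
  (hasGradientAt_phiB hκ Y hc X.fst).gradient

theorem slope_eq' (hκ : 1 < κ) {X Y : Pt n} (hc : 0 < c κ X Y) :
    slope κ X Y = (1 / (κ * ‖X - Y‖ - (Y.snd - X.snd))) • (Y.fst - X.fst) := by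
  have hk := kpos hκ
  rw [slope_eq hκ hc, norm_hv_c hκ, mul_div_cancel₀ _ hk.ne']

theorem norm_hv_c_pos (hκ : 1 < κ) {X Y : Pt n} (hc : 0 < c κ X Y) (x : Src n) :
    0 < ‖hv κ Y (c κ X Y) x‖ := by
  have hk := kpos hκ
  exact (by positivity : 0 < c κ X Y / (κ ^ 2 - 1)).trans_le (le_norm_hv hκ _ _ _)

theorem norm_slope_le (hκ : 1 < κ) {X Y : Pt n} (hc : 0 < c κ X Y) :
    ‖slope κ X Y‖ ≤ 1 / Real.sqrt (κ ^ 2 - 1) := by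
  have hk := kpos hκ
  have h0 := norm_hv_c_pos hκ hc X.fst
  have h1 := norm_sq_hv hκ Y (c κ X Y) X.fst
  have hs : 0 < Real.sqrt (κ ^ 2 - 1) := Real.sqrt_pos.2 hk
  rw [slope_eq hκ hc, norm_smul, Real.norm_of_nonneg (by positivity), norm_sub_rev]
  set σ := ‖hv κ Y (c κ X Y) X.fst‖
  have h2 : ‖X.fst - Y.fst‖ ≤ Real.sqrt (κ ^ 2 - 1) * σ := by
    apply abs_le_of_sq_le_sq' _ (by positivity) |>.2
    rw [mul_pow, Real.sq_sqrt hk.le, h1, mul_add, mul_div_cancel₀ _ hk.ne']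
    have : 0 ≤ (κ ^ 2 - 1) * (c κ X Y / (κ ^ 2 - 1)) ^ 2 := by positivity
    linarith
  rw [one_div_mul_eq_div, div_le_div_iff₀ (by positivity) hs]
  calc ‖X.fst - Y.fst‖ * Real.sqrt (κ ^ 2 - 1)
      ≤ Real.sqrt (κ ^ 2 - 1) * σ * Real.sqrt (κ ^ 2 - 1) := by gcongr
    _ = 1 * ((κ ^ 2 - 1) * σ) := by
      nth_rewrite 3 [← Real.sq_sqrt hk.le]; ring

theorem norm_Lam {v : Src n} (hv : (κ ^ 2 - 1) * ‖v‖ ^ 2 ≤ 1) : ‖Lam κ v‖ = 1 := by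
  have h1 : Real.sqrt (1 - (κ ^ 2 - 1) * ‖v‖ ^ 2) ^ 2 = 1 - (κ ^ 2 - 1) * ‖v‖ ^ 2 :=
    Real.sq_sqrt (by linarith)
  rw [← sq_eq_sq₀ (norm_nonneg _) zero_le_one, norm_sq_pt, Lam, pt_fst, pt_snd, norm_smul, mul_pow,
    Real.norm_eq_abs, sq_abs, Q]
  set w := Real.sqrt (1 - (κ ^ 2 - 1) * ‖v‖ ^ 2)
  have h2 : 0 < 1 + ‖v‖ ^ 2 := by positivity
  field_simp
  linear_combination (1 + ‖v‖ ^ 2) * h1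

theorem Q_pos (hκ : 1 < κ) (v : Src n) : 0 < Q κ v := by
  have hk := kpos hκ
  apply div_pos _ (by positivity)
  have : Real.sqrt (1 - (κ ^ 2 - 1) * ‖v‖ ^ 2) ≤ 1 := by
    rw [Real.sqrt_le_one]
    have : 0 ≤ (κ ^ 2 - 1) * ‖v‖ ^ 2 := by positivity
    linarith
  linarith

/-- The hyperboloid through `X` with focus on the ray from `X` in direction `Λ(v)` has slope `v`
at `X`. -/
theorem slope_add_smul_Lam (hκ : 1 < κ) {X Y : Pt n} (hc : 0 < c κ X Y) {v : Src n}
    (hv : (κ ^ 2 - 1) * ‖v‖ ^ 2 ≤ 1) {s : ℝ} (hs : 0 < s) (e : Y = X + s • Lam κ v) :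
    slope κ X Y = v := by
  have hQ := Q_pos hκ v
  have h1 : ‖X - Y‖ = s := by
    rw [e, norm_sub_rev, add_sub_cancel_left, norm_smul, norm_Lam hv, mul_one,
      Real.norm_of_nonneg hs.le]
  have h2 : Y.fst - X.fst = (s * Q κ v) • v := by
    rw [e, WithLp.add_fst, add_sub_cancel_left, WithLp.smul_fst, Lam, pt_fst, smul_smul]
  have h3 : Y.snd - X.snd = s * (κ - Q κ v) := by
    rw [e, WithLp.add_snd, add_sub_cancel_left, WithLp.smul_snd, Lam, pt_snd, smul_eq_mul]
  rw [slope_eq' hκ hc, h1, h2, h3, smul_smul]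
  have : 1 / (κ * s - s * (κ - Q κ v)) * (s * Q κ v) = 1 := by
    rw [show κ * s - s * (κ - Q κ v) = s * Q κ v by ring]
    field_simp
  rw [this, one_smul]

/-- Snell's law read backwards. With `r = ‖X - Y‖` and `h` the height difference, the slope `v`
satisfies `√(1 - (κ² - 1)|v|²) = (κ h - r) / (κ r - h)`, the positive root because `κ h - r` is `c`.
Hence `Q(v) = (κ r - h) / r` and `Λ(v) = (Y - X) / r`. -/
theorem eq_add_smul_Lam_slope (hκ : 1 < κ) {X Y : Pt n} (hc : 0 < c κ X Y) :
    0 < ‖X - Y‖ ∧ Y = X + ‖X - Y‖ • Lam κ (slope κ X Y) := by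
  have hk := kpos hκ
  have hσ := norm_hv_c_pos hκ hc X.fst
  rw [norm_hv_c hκ] at hσ
  have hN : 0 < κ * ‖X - Y‖ - (Y.snd - X.snd) := by
    rw [div_pos_iff_of_pos_right hk] at hσ; exact hσ
  have h2 := norm_sq_pt (X - Y)
  rw [WithLp.sub_fst, WithLp.sub_snd] at h2
  have hr0 := norm_nonneg (X - Y)
  have hc' : 0 < κ * (Y.snd - X.snd) - ‖X - Y‖ := hc
  have hv := slope_eq' hκ hc
  set r := ‖X - Y‖
  set v := slope κ X Y
  obtain ⟨h, hh⟩ : ∃ h, h = Y.snd - X.snd := ⟨_, rfl⟩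
  rw [← hh] at hN hc' hv
  have hr : 0 < r := by
    rcases hr0.eq_or_lt with h0 | h0
    · rw [← h0] at hN hc'; nlinarith
    · exact h0
  have hnv : ‖v‖ ^ 2 = (r ^ 2 - h ^ 2) / (κ * r - h) ^ 2 := by
    rw [hv, norm_smul, mul_pow, Real.norm_eq_abs, sq_abs, norm_sub_rev, h2, hh]
    field_simp
    ring
  have hw : Real.sqrt (1 - (κ ^ 2 - 1) * ‖v‖ ^ 2) = (κ * h - r) / (κ * r - h) := by
    rw [Real.sqrt_eq_iff_mul_self_eq_of_pos (by positivity), hnv]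
    field_simp
    ring
  have hD : 0 < κ ^ 2 * r - 2 * κ * h + r := by
    have h4 : h ≤ r := by
      have : h ^ 2 ≤ r ^ 2 := by rw [h2, hh]; nlinarith [sq_nonneg ‖X.fst - Y.fst‖]
      exact (abs_le_of_sq_le_sq' this hr.le).2
    have h5 : 0 < κ := by linarith
    nlinarith [mul_pos hr (sq_pos_of_pos (sub_pos.2 hκ)), mul_le_mul_of_nonneg_left h4 h5.le]
  have hN' := hN.ne'
  have hD' := hD.ne'
  have hQ : Q κ v = (κ * r - h) / r := by
    have e1 : 1 + ‖v‖ ^ 2 = r * (κ ^ 2 * r - 2 * κ * h + r) / (κ * r - h) ^ 2 := by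
      rw [hnv, eq_div_iff (pow_ne_zero 2 hN'), add_mul, div_mul_cancel₀ _ (pow_ne_zero 2 hN')]
      ring
    have e2 : κ - (κ * h - r) / (κ * r - h) = (κ ^ 2 * r - 2 * κ * h + r) / (κ * r - h) := by
      rw [eq_div_iff hN', sub_mul, div_mul_cancel₀ _ hN']
      ring
    rw [Q, hw, e1, e2]
    generalize κ ^ 2 * r - 2 * κ * h + r = D at *
    generalize κ * r - h = N at *
    field_simp
  refine ⟨hr, ?_⟩
  have f1 : r • Q κ v • v = Y.fst - X.fst := by
    rw [hQ, hv, smul_smul, smul_smul]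
    have : r * ((κ * r - h) / r) * (1 / (κ * r - h)) = 1 := by
      generalize κ * r - h = N at *
      field_simp
    rw [mul_assoc, ← mul_assoc, this, one_smul]
  have f2 : r * (κ - Q κ v) = Y.snd - X.snd := by
    rw [hQ, ← hh]; field_simp; ring
  rw [← pt_eta Y, ← pt_eta (X + _)]
  congr 1
  · rw [WithLp.add_fst, WithLp.smul_fst, Lam, pt_fst, f1, add_sub_cancel]
  · rw [WithLp.add_snd, WithLp.smul_snd, Lam, pt_snd, smul_eq_mul, f2, add_sub_cancel]

/-- The slope determines the ray from `X`, and the radial graph meets each ray at most once. -/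
theorem Config.slope_inj {τ₀ τ₁ ω : ℝ} {Ω : Set (Src n)} {target : Set (Pt n)}
    (h : Config κ τ₀ τ₁ ω Ω target) {X : Pt n} (hX : X ∈ cyl Ω τ₀)
    {Y Y' : Pt n} (hY : Y ∈ target) (hY' : Y' ∈ target) (e : slope κ X Y = slope κ X Y') :
    Y = Y' := by
  obtain ⟨h1, e1⟩ := eq_add_smul_Lam_slope h.one_lt_kappa (h.beta_pos.trans_le (h.beta_le_c hX hY))
  obtain ⟨h2, e2⟩ := eq_add_smul_Lam_slope h.one_lt_kappa
    (h.beta_pos.trans_le (h.beta_le_c hX hY'))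
  rw [← e] at e2
  exact h.eq_of_ray hX hY hY' h1 h2 e1 e2

/-- `Λ(v)` is a unit vector only for `(κ² - 1)|v|² ≤ 1`. All slopes lie in this ball, which is
convex, so it contains `v(t)`. -/
theorem Config.slope_segPts {τ₀ τ₁ ω : ℝ} {Ω : Set (Src n)} {target : Set (Pt n)}
    (h : Config κ τ₀ τ₁ ω Ω target) {X : Pt n} (hX : X ∈ cyl Ω τ₀)
    {Ybar Yhat Y : Pt n} (hYb : Ybar ∈ target) (hYh : Yhat ∈ target) {t : ℝ} (ht0 : 0 ≤ t)
    (ht1 : t ≤ 1) (hY : Y ∈ segPts κ target X Ybar Yhat t) :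
    slope κ X Y = vAt κ X Ybar Yhat t := by
  obtain ⟨hYt, s, hs, e⟩ := hY
  have hκ := h.one_lt_kappa
  have hk := kpos hκ
  have hpos : ∀ Y ∈ target, 0 < c κ X Y := fun Y hY => h.beta_pos.trans_le (h.beta_le_c hX hY)
  refine slope_add_smul_Lam hκ (hpos _ hYt) ?_ hs e
  have hv : ‖vAt κ X Ybar Yhat t‖ ≤ 1 / Real.sqrt (κ ^ 2 - 1) := by
    have h1 := mul_le_mul_of_nonneg_left (norm_slope_le hκ (hpos _ hYb)) (sub_nonneg.2 ht1)
    have h2 := mul_le_mul_of_nonneg_left (norm_slope_le hκ (hpos _ hYh)) ht0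
    refine (norm_add_le _ _).trans ?_
    rw [norm_smul, norm_smul, Real.norm_of_nonneg ht0, Real.norm_of_nonneg (sub_nonneg.2 ht1)]
    linarith
  have hs : 0 < Real.sqrt (κ ^ 2 - 1) := Real.sqrt_pos.2 hk
  calc (κ ^ 2 - 1) * ‖vAt κ X Ybar Yhat t‖ ^ 2
      ≤ (κ ^ 2 - 1) * (1 / Real.sqrt (κ ^ 2 - 1)) ^ 2 := by gcongr
    _ = 1 := by rw [div_pow, Real.sq_sqrt hk.le]; field_simp

end Slopes

/-! ### The common Lorentz form and the intersection of two hyperboloids -/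

section QuadraticForm

variable {n : ℕ} {κ : ℝ}

theorem phi_sub_eq (hκ : 1 < κ) (Z Y : Pt n) (x : Src n) :
    phi κ x Y Z - Z.snd = ‖hv κ Y (c κ Z Y) Z.fst‖ - ‖hv κ Y (c κ Z Y) x‖ := by
  have := phi_eq_increment hκ Y Z (x - Z.fst)
  rw [add_sub_cancel] at this
  rw [this]; ring

/-- The graph of `φ(·, Y, Z)` is the zero set of a quadric whose quadratic part, up to a factor,
does not depend on `Y`. -/
theorem quadric_identity (hκ : 1 < κ) {Z Y : Pt n} (hc : 0 < c κ Z Y) (x : Src n) (τ : ℝ) :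
    τ - ⟪slope κ Z Y, x - Z.fst⟫
        + 1 / (2 * ‖hv κ Y (c κ Z Y) Z.fst‖) * (‖x - Z.fst‖ ^ 2 / (κ ^ 2 - 1) - τ ^ 2)
      = (τ - (phi κ x Y Z - Z.snd))
        * (‖hv κ Y (c κ Z Y) x‖ + ‖hv κ Y (c κ Z Y) Z.fst‖ - τ)
        / (2 * ‖hv κ Y (c κ Z Y) Z.fst‖) := by
  have hk := kpos hκ
  have hσ := norm_hv_c_pos hκ hc Z.fst
  have h1 := norm_sq_hv hκ Y (c κ Z Y) Z.fst
  have h2 := norm_sq_hv hκ Y (c κ Z Y) x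
  rw [phi_sub_eq hκ, slope_eq hκ hc, real_inner_smul_left]
  set σ := ‖hv κ Y (c κ Z Y) Z.fst‖
  set S := ‖hv κ Y (c κ Z Y) x‖
  have h3 : ‖x - Y.fst‖ ^ 2 = ‖x - Z.fst‖ ^ 2 + 2 * ⟪x - Z.fst, Z.fst - Y.fst⟫
      + ‖Z.fst - Y.fst‖ ^ 2 := by
    rw [← norm_add_sq_real]; congr 2; abel
  have h4 : ⟪Y.fst - Z.fst, x - Z.fst⟫ = -⟪x - Z.fst, Z.fst - Y.fst⟫ := by
    rw [← neg_sub Z.fst, inner_neg_left, real_inner_comm]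
  have h5 : S ^ 2 - σ ^ 2 = (‖x - Z.fst‖ ^ 2 + 2 * ⟪x - Z.fst, Z.fst - Y.fst⟫) / (κ ^ 2 - 1) := by
    rw [h1, h2, h3]; ring
  have h6 : (κ ^ 2 - 1) * (S ^ 2 - σ ^ 2)
      = ‖x - Z.fst‖ ^ 2 + 2 * ⟪x - Z.fst, Z.fst - Y.fst⟫ := by
    rw [h5]; field_simp
  rw [h4]
  field_simp
  linear_combination -h6

/-- A hyperboloid is uniformly spacelike. -/
theorem spacelike_lower (hκ : 1 < κ) {Z Y : Pt n} {ρ s : ℝ} (hρ : 0 ≤ ρ)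
    (hc : ρ ≤ c κ Z Y / (κ ^ 2 - 1)) (x : Src n)
    (h1 : ‖hv κ Y (c κ Z Y) Z.fst‖ ≤ s) (h2 : ‖hv κ Y (c κ Z Y) x‖ ≤ s) :
    ρ ^ 2 * ‖x - Z.fst‖ ^ 2 / (κ ^ 2 - 1)
      ≤ s ^ 2 * (‖x - Z.fst‖ ^ 2 / (κ ^ 2 - 1) - (phi κ x Y Z - Z.snd) ^ 2) := by
  have hk := kpos hκ
  rw [phi_sub_eq hκ]
  have e1 := norm_sq_hv hκ Y (c κ Z Y) Z.fst
  have e2 := norm_sq_hv hκ Y (c κ Z Y) x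
  have n1 := norm_nonneg (hv κ Y (c κ Z Y) Z.fst)
  have n2 := norm_nonneg (hv κ Y (c κ Z Y) x)
  set σ := ‖hv κ Y (c κ Z Y) Z.fst‖
  set S := ‖hv κ Y (c κ Z Y) x‖
  set b := c κ Z Y / (κ ^ 2 - 1)
  have h3 : ‖x - Z.fst‖ ^ 2 = ‖x - Y.fst‖ ^ 2 - 2 * ⟪x - Y.fst, Z.fst - Y.fst⟫
      + ‖Z.fst - Y.fst‖ ^ 2 := by
    rw [← norm_sub_sq_real]; congr 2; abel
  have h4 : ⟪x - Y.fst, Z.fst - Y.fst⟫ ^ 2 ≤ ‖x - Y.fst‖ ^ 2 * ‖Z.fst - Y.fst‖ ^ 2 := by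
    rw [← mul_pow, ← sq_abs]
    gcongr
    exact abs_real_inner_le_norm _ _
  set I := ⟪x - Y.fst, Z.fst - Y.fst⟫
  set A := ‖Z.fst - Y.fst‖ ^ 2
  set B := ‖x - Y.fst‖ ^ 2
  -- `J` is the inner product of the vectors `hv` at `x` and at `Z.fst`. The Lorentz form equals `2
  -- (σ S - J)`, and `(σ S)² - J²` is the Gram determinant of the two vectors.
  obtain ⟨J, hJ⟩ : ∃ J, J = b ^ 2 + I / (κ ^ 2 - 1) := ⟨_, rfl⟩
  have q : ‖x - Z.fst‖ ^ 2 / (κ ^ 2 - 1) - (σ - S) ^ 2 = 2 * (σ * S - J) := by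
    rw [h3, hJ, sub_sq, e1, e2]; ring
  have p : (σ * S) ^ 2 - J ^ 2 = b ^ 2 * (‖x - Z.fst‖ ^ 2 / (κ ^ 2 - 1))
      + (B * A - I ^ 2) / (κ ^ 2 - 1) ^ 2 := by
    rw [mul_pow, e1, e2, hJ, h3]; field_simp; ring
  have p1 : 0 ≤ (B * A - I ^ 2) / (κ ^ 2 - 1) ^ 2 := div_nonneg (by linarith) (by positivity)
  have p2 : ρ ^ 2 * (‖x - Z.fst‖ ^ 2 / (κ ^ 2 - 1)) ≤ b ^ 2 * (‖x - Z.fst‖ ^ 2 / (κ ^ 2 - 1)) := by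
    gcongr
  have p3 : 0 ≤ ρ ^ 2 * (‖x - Z.fst‖ ^ 2 / (κ ^ 2 - 1)) := by positivity
  have p4 : J ≤ σ * S := (abs_le_of_sq_le_sq' (by linarith) (by positivity)).2
  have p5 : σ * S ≤ s ^ 2 := by rw [sq]; gcongr; exact n1.trans h1
  rw [q]
  have p6 : (σ * S - J) * (σ * S + J) ≤ (σ * S - J) * (2 * s ^ 2) := by
    apply mul_le_mul_of_nonneg_left _ (by linarith)
    linarith
  rw [mul_div_assoc]
  linarith

theorem abs_phi_sub_snd_le (hκ : 1 < κ) (Z Y : Pt n) (x : Src n) :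
    |phi κ x Y Z - Z.snd| ≤ ‖x - Z.fst‖ / Real.sqrt (κ ^ 2 - 1) := by
  have := abs_phiB_sub_le hκ Y (c κ Z Y) x Z.fst
  have h2 := phi_self hκ Y Z
  rw [phi] at h2 ⊢
  rwa [h2] at this

/-- In dimension at least two, two hyperboloids through `Z` meet again arbitrarily close to `Z`. -/
theorem exists_phi_eq (hn : 2 ≤ n) (hκ : 1 < κ) {Z Y Y' : Pt n} (hc : 0 < c κ Z Y)
    (hc' : 0 < c κ Z Y') (hne : slope κ Z Y ≠ slope κ Z Y') {R : ℝ} (hR : 0 < R) :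
    ∃ x, 0 < ‖x - Z.fst‖ ∧ ‖x - Z.fst‖ < R ∧ phi κ x Y Z = phi κ x Y' Z := by
  set w := slope κ Z Y - slope κ Z Y' with hw
  have hw0 : 0 < ‖w‖ := norm_pos_iff.2 (sub_ne_zero.2 hne)
  set f : Src n → ℝ := fun x => phi κ x Y Z - phi κ x Y' Z with hf
  have hf0 : f Z.fst = 0 := by simp only [hf, phi_self hκ, sub_self]
  have hfc : Continuous f := by
    have h1 := continuous_phiB (κ := κ) Y (c κ Z Y)
    have h2 := continuous_phiB (κ := κ) Y' (c κ Z Y')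
    exact h1.sub h2
  have hfd : HasFDerivAt f (InnerProductSpace.toDual ℝ (Src n) w) Z.fst := by
    have h1 := (hasGradientAt_phiB hκ Y hc Z.fst).hasFDerivAt
    have h2 := (hasGradientAt_phiB hκ Y' hc' Z.fst).hasFDerivAt
    rw [← slope_eq hκ hc] at h1
    rw [← slope_eq hκ hc'] at h2
    rw [hw, map_sub]
    exact h1.sub h2
  have hl : HasDerivAt (fun s : ℝ => Z.fst + s • w) w 0 := by
    simpa using ((hasDerivAt_id (0 : ℝ)).smul_const w).const_add Z.fst
  have hg : HasDerivAt (fun s : ℝ => f (Z.fst + s • w)) (‖w‖ ^ 2) 0 := by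
    have := HasFDerivAt.comp_hasDerivAt (x := (0 : ℝ)) (f := fun s : ℝ => Z.fst + s • w)
      (l := f) (l' := InnerProductSpace.toDual ℝ (Src n) w) (by simpa using hfd) hl
    rwa [InnerProductSpace.toDual_apply_apply, real_inner_self_eq_norm_sq] at this
  have hsl := hasDerivAt_iff_tendsto_slope.1 hg
  have ev : ∀ᶠ s in 𝓝[≠] (0 : ℝ), 0 < _root_.slope (fun s : ℝ => f (Z.fst + s • w)) 0 s :=
    hsl.eventually (lt_mem_nhds (by positivity))
  rw [eventually_nhdsWithin_iff, Metric.eventually_nhds_iff] at ev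
  obtain ⟨ε, hε, hev⟩ := ev
  obtain ⟨s, hs0, hs⟩ : ∃ s : ℝ, 0 < s ∧ s < min ε (R / ‖w‖) :=
    exists_between (lt_min hε (by positivity))
  have hsε := hs.trans_le (min_le_left _ _)
  have hsR : s * ‖w‖ < R := by
    rw [← lt_div_iff₀ hw0]; exact hs.trans_le (min_le_right _ _)
  have e1 := hev (y := s) (by simpa [abs_of_pos hs0] using hsε) hs0.ne'
  have e2 := hev (y := -s) (by simpa [abs_of_pos hs0] using hsε) (by simpa using hs0.ne')
  rw [slope_def_field, zero_smul, add_zero, hf0, sub_zero, sub_zero] at e1 e2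
  rw [div_pos_iff_of_pos_right hs0] at e1
  have e2' : f (Z.fst + (-s) • w) < 0 := by
    by_contra hcon
    have : f (Z.fst + (-s) • w) / (-s) ≤ 0 :=
      div_nonpos_of_nonneg_of_nonpos (not_lt.1 hcon) (by linarith)
    linarith
  -- The difference of the two hyperboloids has opposite signs at `Z.fst ± s • w`, `w` being its
  -- gradient. Spheres are connected from dimension two on, so it vanishes somewhere on this one.
  have hrank : 1 < Module.rank ℝ (Src n) := by
    rw [← Module.finrank_eq_rank, finrank_euclideanSpace_fin]
    exact_mod_cast hn
  have hpre := isPreconnected_sphere hrank Z.fst (s * ‖w‖)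
  have m1 : Z.fst + s • w ∈ Metric.sphere Z.fst (s * ‖w‖) := by
    simp [norm_smul, abs_of_pos hs0]
  have m2 : Z.fst + (-s) • w ∈ Metric.sphere Z.fst (s * ‖w‖) := by
    simp [norm_smul, abs_of_pos hs0]
  obtain ⟨x, hx, hx0⟩ := hpre.intermediate_value m2 m1 hfc.continuousOn
    (Set.mem_Icc.2 ⟨e2'.le, e1.le⟩)
  rw [mem_sphere_iff_norm] at hx
  exact ⟨x, by rw [hx]; positivity, by rwa [hx], sub_eq_zero.1 hx0⟩

end QuadraticForm

/-! ### From the local maximum principle to the global one -/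

section MaxPrinciple

variable {n : ℕ} {κ τ₀ τ₁ ω : ℝ} {Ω : Set (Src n)} {target : Set (Pt n)}

/-- An upper bound for the square root in `phi` on the source. -/
noncomputable def sqrtBound (κ τ₁ ω D : ℝ) : ℝ :=
  κ * (τ₁ + ω) / (κ ^ 2 - 1) + D / Real.sqrt (κ ^ 2 - 1)

theorem Config.c_pos (h : Config κ τ₀ τ₁ ω Ω target) {X Y : Pt n} (hX : X ∈ cyl Ω τ₀)
    (hY : Y ∈ target) : 0 < c κ X Y := h.beta_pos.trans_le (h.beta_le_c hX hY)

theorem Config.le_norm_hv_c (h : Config κ τ₀ τ₁ ω Ω target) {Z Y : Pt n} (hZ : Z ∈ cyl Ω τ₀)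
    (hY : Y ∈ target) (x : Src n) :
    beta κ τ₀ τ₁ / (κ ^ 2 - 1) ≤ ‖hv κ Y (c κ Z Y) x‖ := by
  have hk := kpos h.one_lt_kappa
  refine le_trans ?_ (le_norm_hv h.one_lt_kappa _ _ _)
  have := h.beta_le_c hZ hY
  gcongr

theorem Config.norm_hv_c_le (h : Config κ τ₀ τ₁ ω Ω target) {Z Y : Pt n} (hZ : Z ∈ cyl Ω τ₀)
    (hY : Y ∈ target) {x : Src n} (hx : x ∈ Ω) :
    ‖hv κ Y (c κ Z Y) x‖ ≤ sqrtBound κ τ₁ ω (bigDelta Ω target) := by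
  have hκ := h.one_lt_kappa
  have hk := kpos hκ
  have hs : 0 < Real.sqrt (κ ^ 2 - 1) := Real.sqrt_pos.2 hk
  have h1 := h.c_le hZ hY
  have h2 := h.norm_sub_fst_le hx hY
  have h3 := h.c_pos hZ hY
  have h4 : ‖hv κ Y (c κ Z Y) x‖
      ≤ c κ Z Y / (κ ^ 2 - 1) + ‖x - Y.fst‖ / Real.sqrt (κ ^ 2 - 1) := by
    apply abs_le_of_sq_le_sq' _ (by positivity) |>.2
    rw [norm_sq_hv hκ, add_sq, div_pow ‖x - Y.fst‖, Real.sq_sqrt hk.le]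
    have : 0 ≤ 2 * (c κ Z Y / (κ ^ 2 - 1)) * (‖x - Y.fst‖ / Real.sqrt (κ ^ 2 - 1)) := by
      positivity
    linarith
  refine h4.trans ?_
  unfold sqrtBound
  gcongr

theorem inner_vAt (Z Ybar Yhat : Pt n) (t : ℝ) (ξ : Src n) :
    ⟪vAt κ Z Ybar Yhat t, ξ⟫ = (1 - t) * ⟪slope κ Z Ybar, ξ⟫ + t * ⟪slope κ Z Yhat, ξ⟫ := by
  rw [vAt, inner_add_left, real_inner_smul_left, real_inner_smul_left]

theorem Config.spacelike_pos (h : Config κ τ₀ τ₁ ω Ω target) {Z Y : Pt n} (hZ : Z ∈ cyl Ω τ₀)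
    (hY : Y ∈ target) {x : Src n} (hx : x ∈ Ω) :
    (beta κ τ₀ τ₁ / (κ ^ 2 - 1)) ^ 2 * ‖x - Z.fst‖ ^ 2 / (κ ^ 2 - 1)
      / sqrtBound κ τ₁ ω (bigDelta Ω target) ^ 2
      ≤ ‖x - Z.fst‖ ^ 2 / (κ ^ 2 - 1) - (phi κ x Y Z - Z.snd) ^ 2 := by
  have hκ := h.one_lt_kappa
  have hk := kpos hκ
  have hβ := h.beta_pos
  have hρ : 0 < beta κ τ₀ τ₁ / (κ ^ 2 - 1) := by positivity
  have h1 := h.norm_hv_c_le hZ hY hx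
  have hs := hρ.trans_le ((h.le_norm_hv_c hZ hY x).trans h1)
  rw [div_le_iff₀ (by positivity), mul_comm _ (sqrtBound _ _ _ _ ^ 2)]
  have := h.beta_le_c hZ hY
  exact spacelike_lower hκ hρ.le (by gcongr) x (h.norm_hv_c_le hZ hY hZ.1) h1

/-- In dimension at least two the local maximum principle with quadratic gain is a strict concavity
property of `1 / (2σ)` as a function of the slope. -/
theorem Config.concavity_of_local (h : Config κ τ₀ τ₁ ω Ω target) (hn : 2 ≤ n) {Z : Pt n}
    (hZ : Z ∈ cyl Ω τ₀) {Ybar Yhat Y : Pt n} (hYb : Ybar ∈ target) (hYh : Yhat ∈ target)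
    (hY : Y ∈ target) (hne : Ybar ≠ Yhat) {t : ℝ}
    (hs : slope κ Z Y = vAt κ Z Ybar Yhat t) {γ R : ℝ} (hγ : 0 ≤ γ) (hR : 0 < R)
    (hloc : ∀ x ∈ Ω, ‖x - Z.fst‖ ≤ R →
      phi κ x Y Z ≤ max (phi κ x Ybar Z) (phi κ x Yhat Z) - γ * ‖x - Z.fst‖ ^ 2) :
    (1 - t) * (1 / (2 * ‖hv κ Ybar (c κ Z Ybar) Z.fst‖))
      + t * (1 / (2 * ‖hv κ Yhat (c κ Z Yhat) Z.fst‖)) + (κ ^ 2 - 1) / 2 * γ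
      ≤ 1 / (2 * ‖hv κ Y (c κ Z Y) Z.fst‖) := by
  have hκ := h.one_lt_kappa
  have hk := kpos hκ
  have hβ := h.beta_pos
  have hρ : 0 < beta κ τ₀ τ₁ / (κ ^ 2 - 1) := by positivity
  have hsq : 0 < Real.sqrt (κ ^ 2 - 1) := Real.sqrt_pos.2 hk
  obtain ⟨ε, hε, hball⟩ := Metric.isOpen_iff.1 h.isOpen_source Z.fst hZ.1
  -- The last bound on `‖x - Z.fst‖` ensures `τ ≤ S` below, hence `S + σ - τ ≥ σ`.
  obtain ⟨x, hx0, hxR, hxe⟩ := exists_phi_eq hn hκ (h.c_pos hZ hYb) (h.c_pos hZ hYh)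
    (fun e => hne (h.slope_inj hZ hYb hYh e))
    (lt_min (lt_min hR hε) (by positivity :
      0 < beta κ τ₀ τ₁ / (κ ^ 2 - 1) * Real.sqrt (κ ^ 2 - 1)))
  have hx : x ∈ Ω := hball (by
    rw [mem_ball_iff_norm]; exact hxR.trans_le ((min_le_left _ _).trans (min_le_right _ _)))
  have hl := hloc x hx (hxR.le.trans ((min_le_left _ _).trans (min_le_left _ _)))
  rw [← hxe, max_self] at hl
  have i1 := quadric_identity hκ (h.c_pos hZ hYb) x (phi κ x Ybar Z - Z.snd)
  have i2 := quadric_identity hκ (h.c_pos hZ hYh) x (phi κ x Ybar Z - Z.snd)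
  have i3 := quadric_identity hκ (h.c_pos hZ hY) x (phi κ x Ybar Z - Z.snd)
  have hq₀ := h.spacelike_pos hZ hYb hx
  have hS := hρ.trans_le ((h.le_norm_hv_c hZ hYb x).trans (h.norm_hv_c_le hZ hYb hx))
  have qpos := lt_of_lt_of_le (by positivity) hq₀
  have hτ := (le_abs_self _).trans (abs_phi_sub_snd_le hκ Z Ybar x)
  have hτ2 : ‖x - Z.fst‖ / Real.sqrt (κ ^ 2 - 1) ≤ beta κ τ₀ τ₁ / (κ ^ 2 - 1) := by
    rw [div_le_iff₀ hsq]; exact hxR.le.trans (min_le_right _ _)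
  have hSx := h.le_norm_hv_c hZ hY x
  have hσ := norm_hv_c_pos hκ (h.c_pos hZ hY) Z.fst
  rw [← hxe] at i2
  rw [sub_self, zero_mul, zero_div] at i1 i2
  rw [hs, inner_vAt] at i3
  set τ := phi κ x Ybar Z - Z.snd with hτdef
  set S := ‖hv κ Y (c κ Z Y) x‖
  set σ := ‖hv κ Y (c κ Z Y) Z.fst‖
  set gb := 1 / (2 * ‖hv κ Ybar (c κ Z Ybar) Z.fst‖)
  set gh := 1 / (2 * ‖hv κ Yhat (c κ Z Yhat) Z.fst‖)
  set q := ‖x - Z.fst‖ ^ 2 / (κ ^ 2 - 1) - τ ^ 2 with hq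
  have key : γ * ‖x - Z.fst‖ ^ 2 / 2 ≤ (τ - (phi κ x Y Z - Z.snd)) * (S + σ - τ) / (2 * σ) := by
    rw [div_le_div_iff₀ two_pos (by positivity)]
    have h1 : γ * ‖x - Z.fst‖ ^ 2 ≤ τ - (phi κ x Y Z - Z.snd) := by linarith
    have h0 : 0 ≤ γ * ‖x - Z.fst‖ ^ 2 := by positivity
    have h2 : γ * ‖x - Z.fst‖ ^ 2 * σ ≤ (τ - (phi κ x Y Z - Z.snd)) * (S + σ - τ) :=
      mul_le_mul h1 (by linarith) hσ.le (h0.trans h1)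
    linarith
  rw [← i3] at key
  -- Both end quadrics vanish at height `τ` over `x`. Subtracting their weighted average cancels the
  -- slopes and leaves the difference of the coefficients times `q`.
  have id : γ * ‖x - Z.fst‖ ^ 2 / 2 ≤ (1 / (2 * σ) - ((1 - t) * gb + t * gh)) * q := by
    linear_combination key + (1 - t) * i1 + t * i2
  have hnn : 0 ≤ 1 / (2 * σ) - ((1 - t) * gb + t * gh) := by
    by_contra hcon
    have := mul_neg_of_neg_of_pos (not_le.1 hcon) qpos
    have : 0 ≤ γ * ‖x - Z.fst‖ ^ 2 / 2 := by positivity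
    linarith
  have hqle : q ≤ ‖x - Z.fst‖ ^ 2 / (κ ^ 2 - 1) := by rw [hq]; linarith [sq_nonneg τ]
  have h5 := id.trans (mul_le_mul_of_nonneg_left hqle hnn)
  have h6 : (κ ^ 2 - 1) / 2 * γ * (‖x - Z.fst‖ ^ 2 / (κ ^ 2 - 1))
      ≤ (1 / (2 * σ) - ((1 - t) * gb + t * gh)) * (‖x - Z.fst‖ ^ 2 / (κ ^ 2 - 1)) := by
    refine le_trans (le_of_eq ?_) h5
    field_simp
  have h7 := le_of_mul_le_mul_right h6 (by positivity)
  linarith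

/-- The constant of the global maximum principle. -/
noncomputable def gainConst (ρ k s : ℝ) : ℝ := ρ ^ 3 / (2 * k * s ^ 3)

/-- Strict concavity of `1 / (2σ)` in the slope gives a global maximum principle. -/
theorem Config.max_principle_of_concavity (h : Config κ τ₀ τ₁ ω Ω target) {Z : Pt n}
    (hZ : Z ∈ cyl Ω τ₀) {Ybar Yhat Y : Pt n} (hYb : Ybar ∈ target) (hYh : Yhat ∈ target)
    (hY : Y ∈ target) {t : ℝ} (ht0 : 0 ≤ t) (ht1 : t ≤ 1)
    (hs : slope κ Z Y = vAt κ Z Ybar Yhat t) {Γ : ℝ} (hΓ : 0 ≤ Γ)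
    (hconc : (1 - t) * (1 / (2 * ‖hv κ Ybar (c κ Z Ybar) Z.fst‖))
      + t * (1 / (2 * ‖hv κ Yhat (c κ Z Yhat) Z.fst‖)) + Γ
      ≤ 1 / (2 * ‖hv κ Y (c κ Z Y) Z.fst‖)) {x : Src n} (hx : x ∈ Ω) :
    phi κ x Y Z ≤ max (phi κ x Ybar Z) (phi κ x Yhat Z)
      - gainConst (beta κ τ₀ τ₁ / (κ ^ 2 - 1)) (κ ^ 2 - 1)
          (sqrtBound κ τ₁ ω (bigDelta Ω target)) * Γ * ‖x - Z.fst‖ ^ 2 := by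
  have hκ := h.one_lt_kappa
  have hk := kpos hκ
  have hβ := h.beta_pos
  have hρ : 0 < beta κ τ₀ τ₁ / (κ ^ 2 - 1) := by positivity
  have hS := hρ.trans_le ((h.le_norm_hv_c hZ hYb x).trans (h.norm_hv_c_le hZ hYb hx))
  rcases (norm_nonneg (x - Z.fst)).eq_or_lt with h0 | h0
  · rw [eq_comm, norm_eq_zero, sub_eq_zero] at h0
    rw [h0, phi_self hκ, phi_self hκ, phi_self hκ]
    simp
  have hq₀ := h.spacelike_pos hZ hY hx
  have hq0 : 0 < (beta κ τ₀ τ₁ / (κ ^ 2 - 1)) ^ 2 * ‖x - Z.fst‖ ^ 2 / (κ ^ 2 - 1)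
      / sqrtBound κ τ₁ ω (bigDelta Ω target) ^ 2 := by positivity
  have qpos := lt_of_lt_of_le hq0 hq₀
  have hτ := (abs_le.1 (abs_phi_sub_snd_le hκ Z Y x))
  have hτlt : phi κ x Y Z - Z.snd < ‖x - Z.fst‖ / Real.sqrt (κ ^ 2 - 1) := by
    apply lt_of_pow_lt_pow_left₀ 2 (by positivity)
    rw [div_pow, Real.sq_sqrt hk.le]
    linarith
  -- the inequality against one endpoint at which the quadric is sufficiently negative
  have main : ∀ Y' ∈ target,
      (phi κ x Y Z - Z.snd) - ⟪slope κ Z Y', x - Z.fst⟫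
        + 1 / (2 * ‖hv κ Y' (c κ Z Y') Z.fst‖)
          * (‖x - Z.fst‖ ^ 2 / (κ ^ 2 - 1) - (phi κ x Y Z - Z.snd) ^ 2)
        ≤ -(Γ * ((beta κ τ₀ τ₁ / (κ ^ 2 - 1)) ^ 2 * ‖x - Z.fst‖ ^ 2 / (κ ^ 2 - 1)
          / sqrtBound κ τ₁ ω (bigDelta Ω target) ^ 2)) →
      phi κ x Y Z ≤ phi κ x Y' Z - gainConst (beta κ τ₀ τ₁ / (κ ^ 2 - 1)) (κ ^ 2 - 1)
          (sqrtBound κ τ₁ ω (bigDelta Ω target)) * Γ * ‖x - Z.fst‖ ^ 2 := by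
    intro Y' hY' hle
    rw [quadric_identity hκ (h.c_pos hZ hY')] at hle
    have l1 := h.le_norm_hv_c hZ hY' Z.fst
    have u1 := h.norm_hv_c_le hZ hY' hZ.1
    have u2 := h.norm_hv_c_le hZ hY' hx
    -- This makes the factor `S + σ - τ` positive, so a negative quadric means that `τ` lies below
    -- the graph of `φ(·, Y', Z)`.
    have tri : ‖x - Z.fst‖ / Real.sqrt (κ ^ 2 - 1)
        ≤ ‖hv κ Y' (c κ Z Y') x‖ + ‖hv κ Y' (c κ Z Y') Z.fst‖ := by
      rw [← norm_shift hκ]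
      have := hv_add (κ := κ) Y' (c κ Z Y') Z.fst (x - Z.fst)
      rw [add_sub_cancel] at this
      rw [← sub_eq_iff_eq_add'.2 this]
      exact norm_sub_le _ _
    set S := ‖hv κ Y' (c κ Z Y') x‖
    set σ := ‖hv κ Y' (c κ Z Y') Z.fst‖
    set ρ := beta κ τ₀ τ₁ / (κ ^ 2 - 1)
    set s := sqrtBound κ τ₁ ω (bigDelta Ω target)
    set τ := phi κ x Y Z - Z.snd
    set r := ‖x - Z.fst‖
    have W0 : 0 < S + σ - τ := by linarith
    have W1 : S + σ - τ ≤ 4 * s := by linarith [hτ.1]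
    have hσ : 0 < σ := hρ.trans_le l1
    rw [div_le_iff₀ (by positivity)] at hle
    set P := Γ * (ρ ^ 2 * r ^ 2 / (κ ^ 2 - 1) / s ^ 2) with hP
    have hP0 : 0 ≤ P := by positivity
    have d1 : P * (2 * ρ) ≤ ((phi κ x Y' Z - Z.snd) - τ) * (S + σ - τ) := by
      have : P * (2 * ρ) ≤ P * (2 * σ) := by gcongr
      linarith
    have d0 : 0 ≤ (phi κ x Y' Z - Z.snd) - τ := by
      by_contra hcon
      have := mul_neg_of_neg_of_pos (not_le.1 hcon) W0
      have : 0 ≤ P * (2 * ρ) := by positivity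
      linarith
    have d2 := d1.trans (mul_le_mul_of_nonneg_left W1 d0)
    rw [← div_le_iff₀ (by positivity)] at d2
    have e : P * (2 * ρ) / (4 * s) = gainConst ρ (κ ^ 2 - 1) s * Γ * r ^ 2 := by
      rw [hP, gainConst]; field_simp; ring
    rw [e] at d2
    have : τ = phi κ x Y Z - Z.snd := rfl
    linarith
  have i3 := quadric_identity hκ (h.c_pos hZ hY) x (phi κ x Y Z - Z.snd)
  rw [sub_self, zero_mul, zero_div, hs, inner_vAt] at i3
  set τ := phi κ x Y Z - Z.snd
  set q := ‖x - Z.fst‖ ^ 2 / (κ ^ 2 - 1) - τ ^ 2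
  set q₀ := (beta κ τ₀ τ₁ / (κ ^ 2 - 1)) ^ 2 * ‖x - Z.fst‖ ^ 2 / (κ ^ 2 - 1)
    / sqrtBound κ τ₁ ω (bigDelta Ω target) ^ 2
  have hc := mul_le_mul_of_nonneg_right hconc qpos.le
  have hΓq : Γ * q₀ ≤ Γ * q := by gcongr
  set Pb := τ - ⟪slope κ Z Ybar, x - Z.fst⟫ + 1 / (2 * ‖hv κ Ybar (c κ Z Ybar) Z.fst‖) * q with hPb
  set Ph := τ - ⟪slope κ Z Yhat, x - Z.fst⟫ + 1 / (2 * ‖hv κ Yhat (c κ Z Yhat) Z.fst‖) * q with hPh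
  -- The quadric of `Y` vanishes at its own height `τ`, so by concavity the average of the end
  -- quadrics is at most `-Γ q₀`; one of them must be too.
  have comb : (1 - t) * Pb + t * Ph ≤ -(Γ * q₀) := by
    rw [hPb, hPh]
    linear_combination hc + hΓq + i3
  by_cases hb : Pb ≤ -(Γ * q₀)
  · exact (main Ybar hYb hb).trans (sub_le_sub_right (le_max_left _ _) _)
  · have hh : Ph ≤ -(Γ * q₀) := by
      by_contra hcon
      have c1 := not_le.1 hb
      have c2 := not_le.1 hcon
      rcases ht0.eq_or_lt with h3 | h3
      · rw [← h3] at comb; linarith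
      · have := mul_lt_mul_of_pos_left c2 h3
        have := mul_le_mul_of_nonneg_left c1.le (sub_nonneg.2 ht1)
        linarith
    exact (main Yhat hYh hh).trans (sub_le_sub_right (le_max_right _ _) _)

end MaxPrinciple

/-! ### Dimension one: local support is global -/

section OneDimension

/-- Every zero is an upcrossing, so `H` stays nonnegative; a zero at `b` would force negative values
just to its left. -/
theorem pos_of_deriv_pos_at_zeros {H H' : ℝ → ℝ} {a b : ℝ} (hab : a < b)
    (hd : ∀ s, HasDerivAt H (H' s) s) (hz : ∀ s ∈ Set.Icc a b, H s = 0 → 0 < H' s)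
    (ha : 0 ≤ H a) : 0 < H b := by
  have hnn : ∀ ⦃s⦄, s ∈ Set.Icc a b → (0 : ℝ) ≤ H s :=
    image_le_of_deriv_right_lt_deriv_boundary (f := fun _ => (0 : ℝ)) (f' := fun _ => 0)
      continuousOn_const (fun x _ => hasDerivWithinAt_const _ _ _) ha hd
      (fun s hs e => hz s (Set.Ico_subset_Icc_self hs) e.symm)
  rcases (hnn (Set.right_mem_Icc.2 hab.le)).eq_or_lt with h0 | h0
  · have hp := hz b (Set.right_mem_Icc.2 hab.le) h0.symm
    have ev := (hasDerivAt_iff_tendsto_slope.1 (hd b)).eventually (lt_mem_nhds hp)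
    have ev2 : ∀ᶠ s in 𝓝[<] b, 0 < _root_.slope H b s :=
      ev.filter_mono (nhdsWithin_mono _ (fun s hs => ne_of_lt hs))
    have ev3 : ∀ᶠ s in 𝓝[<] b, s ∈ Set.Ioo a b := Ioo_mem_nhdsLT hab
    obtain ⟨s, hs1, hs2⟩ := (ev2.and ev3).exists
    rw [slope_def_field, ← h0, sub_zero] at hs1
    have := div_nonpos_of_nonneg_of_nonpos (hnn (Set.Ioo_subset_Icc_self hs2))
      (sub_nonpos.2 hs2.2.le)
    linarith
  · exact h0

variable {κ τ₀ τ₁ ω : ℝ}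

theorem continuous_pt {n : ℕ} : Continuous fun p : Src n × ℝ => pt p.1 p.2 :=
  WithLp.prod_continuous_toLp 2 _ _

theorem Config.isPreconnected_cyl {n : ℕ} {Ω : Set (Src n)} {target : Set (Pt n)}
    (h : Config κ τ₀ τ₁ ω Ω target) : IsPreconnected (cyl Ω τ₀) := by
  have := (h.convex_source.isPreconnected.prod (isPreconnected_Icc (a := 0) (b := τ₀))).image _
    continuous_pt.continuousOn
  convert this using 1
  ext X
  constructor
  · rintro ⟨h1, h2⟩
    exact ⟨(X.fst, X.snd), ⟨h1, h2⟩, rfl⟩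
  · rintro ⟨p, ⟨h1, h2⟩, rfl⟩
    exact ⟨h1, h2⟩

theorem Config.continuousOn_slope {n : ℕ} {Ω : Set (Src n)} {target : Set (Pt n)}
    (h : Config κ τ₀ τ₁ ω Ω target) {Y : Pt n} (hY : Y ∈ target) :
    ContinuousOn (fun X => slope κ X Y) (cyl Ω τ₀) := by
  have hκ := h.one_lt_kappa
  have hk := kpos hκ
  have h1 : Continuous fun X : Pt n => X.fst := WithLp.prod_continuous_ofLp 2 _ _ |>.fst
  have h2 : Continuous fun X : Pt n => X.snd := WithLp.prod_continuous_ofLp 2 _ _ |>.snd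
  have h3 : ContinuousOn (fun X : Pt n => 1 / (κ * ‖X - Y‖ - (Y.snd - X.snd))) (cyl Ω τ₀) := by
    apply ContinuousOn.div continuousOn_const (by fun_prop)
    intro X hX
    have := norm_hv_c_pos hκ (h.c_pos hX hY) X.fst
    rw [norm_hv_c hκ, div_pos_iff_of_pos_right hk] at this
    exact this.ne'
  exact (h3.smul (continuous_const.sub h1).continuousOn).congr
    fun X hX => slope_eq' hκ (h.c_pos hX hY)

theorem phiB_concave {n : ℕ} (hκ : 1 < κ) (Y : Pt n) (b : ℝ) (x e : Src n) {s : ℝ} (hs0 : 0 ≤ s)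
    (hs1 : s ≤ 1) : (1 - s) * phiB κ Y b x + s * phiB κ Y b (x + e) ≤ phiB κ Y b (x + s • e) := by
  have h1 := norm_le_convexComb (a := hv κ Y b (x + s • e))
    (k := WithLp.toLp 2 ((0 : ℝ), (Real.sqrt (κ ^ 2 - 1))⁻¹ • e)) hs0 hs1
  rw [← hv_add_smul, ← hv_add_smul] at h1
  have e1 : x + s • e + (-s) • e = x := by module
  have e2 : x + s • e + (1 - s) • e = x + e := by module
  rw [e1, e2] at h1
  rw [phiB_eq hκ, phiB_eq hκ, phiB_eq hκ]
  linarith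

theorem hasDerivAt_phiB_line {n : ℕ} (hκ : 1 < κ) (Y : Pt n) {b : ℝ} (hb : 0 < b)
    (x e : Src n) (s : ℝ) :
    HasDerivAt (fun s : ℝ => phiB κ Y b (x + s • e))
      ⟪slope κ (pt (x + s • e) (phiB κ Y b (x + s • e))) Y, e⟫ s := by
  have hc := c_phiB hκ Y hb.le (x + s • e)
  rw [slope_eq hκ (by rwa [hc]), hc, pt_fst]
  have h1 := (hasGradientAt_phiB hκ Y hb (x + s • e)).hasFDerivAt
  have hl : HasDerivAt (fun s : ℝ => x + s • e) e s := by
    simpa using ((hasDerivAt_id s).smul_const e).const_add x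
  have := h1.comp_hasDerivAt s hl
  rwa [InnerProductSpace.toDual_apply_apply] at this

/-- In dimension one a hyperboloid which supports the refractor locally supports it globally. -/
theorem IsRefractor.le_of_local_support {Ω : Set (Src 1)} {target : Set (Pt 1)}
    (h : Config κ τ₀ τ₁ ω Ω target) {u : Src 1 → ℝ} (hu : IsRefractor κ τ₀ Ω target u)
    {x₁ : Src 1} (hx₁ : x₁ ∈ Ω) {Y : Pt 1} (hY : Y ∈ target) {b : ℝ} (hb : 0 < b)
    (heq : phiB κ Y b x₁ = u x₁) {ε : ℝ} (hε : 0 < ε)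
    (hloc : ∀ x ∈ Ω, ‖x - x₁‖ < ε → phiB κ Y b x ≤ u x) {x : Src 1} (hx : x ∈ Ω) :
    phiB κ Y b x ≤ u x := by
  have hκ := h.one_lt_kappa
  by_contra hcon
  have hlt : u x < phiB κ Y b x := not_le.1 hcon
  have hne : x ≠ x₁ := by rintro rfl; linarith
  set e := x - x₁ with he
  have he0 : e ≠ 0 := sub_ne_zero.2 hne
  have hen : 0 < ‖e‖ := norm_pos_iff.2 he0
  have hxe : x₁ + e = x := by rw [he, add_sub_cancel]
  have mem : ∀ s ∈ Set.Icc (0 : ℝ) 1, x₁ + s • e ∈ Ω := fun s hs =>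
    h.convex_source.add_smul_sub_mem hx₁ hx hs
  obtain ⟨s₂, hs20, hs2⟩ : ∃ s : ℝ, 0 < s ∧ s < min 1 (ε / ‖e‖) :=
    exists_between (lt_min one_pos (by positivity))
  have hs21 := hs2.trans_le (min_le_left _ _)
  have hx2 : x₁ + s₂ • e ∈ Ω := mem s₂ ⟨hs20.le, hs21.le⟩
  have hl2 := hloc _ hx2 (by
    rw [add_sub_cancel_left, norm_smul, Real.norm_of_nonneg hs20.le, ← lt_div_iff₀ hen]
    exact hs2.trans_le (min_le_right _ _))
  -- Compare with a support at a nearby point: the difference would be nonnegative at `0`,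
  -- nonpositive at `s₂` and positive at `1`, so it would have to cross zero in both directions.
  obtain ⟨Y₂, hY₂, b₂, hb₂, hle₂, heq₂⟩ := hu.exists_support h hx2
  have hb₂0 := h.beta_pos.trans_le hb₂
  have g0 := hle₂ x₁ hx₁
  have g1 := hle₂ x hx
  by_cases hYY : Y = Y₂
  · subst hYY
    have k1 : b ≤ b₂ := by
      by_contra hb'
      have := phiB_strictAnti hκ Y hb₂0.le (not_le.1 hb') x₁
      linarith
    have := phiB_anti hκ Y hb.le k1
    rcases k1.eq_or_lt with k2 | k2
    · rw [← k2] at g1; linarith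
    · have := phiB_strictAnti hκ Y hb.le k2 (x₁ + s₂ • e)
      linarith
  -- `Θ` is the derivative of the difference where the two hyperboloids meet. In dimension one
  -- distinct slopes make it nonzero, so it keeps one sign on the connected cylinder.
  · set Θ : Pt 1 → ℝ := fun X => ⟪slope κ X Y - slope κ X Y₂, e⟫ with hΘ
    have hΘ0 : ∀ X ∈ cyl Ω τ₀, Θ X ≠ 0 := by
      intro X hX h0
      have hw : slope κ X Y - slope κ X Y₂ ≠ 0 :=
        sub_ne_zero.2 fun e' => hYY (h.slope_inj hX hY hY₂ e')
      have ne0 : ∀ w : Src 1, w ≠ 0 → w 0 ≠ 0 := by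
        intro w hw h0
        apply hw
        ext i
        rw [Subsingleton.elim i 0, h0]; rfl
      have : (slope κ X Y - slope κ X Y₂) 0 * e 0 = 0 := by
        simp only [hΘ, PiLp.inner_apply, Fin.sum_univ_one, Fin.isValue] at h0
        simpa [mul_comm] using h0
      rcases mul_eq_zero.1 this with h' | h'
      · exact ne0 _ hw h'
      · exact ne0 _ he0 h'
    have hΘc : ContinuousOn Θ (cyl Ω τ₀) :=
      ((h.continuousOn_slope hY).sub (h.continuousOn_slope hY₂)).inner continuousOn_const
    set H : ℝ → ℝ := fun s => phiB κ Y b (x₁ + s • e) - phiB κ Y₂ b₂ (x₁ + s • e) with hH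
    set H' : ℝ → ℝ := fun s =>
      ⟪slope κ (pt (x₁ + s • e) (phiB κ Y b (x₁ + s • e))) Y, e⟫
        - ⟪slope κ (pt (x₁ + s • e) (phiB κ Y₂ b₂ (x₁ + s • e))) Y₂, e⟫ with hH'
    have hd : ∀ s, HasDerivAt H (H' s) s := fun s =>
      (hasDerivAt_phiB_line hκ Y hb x₁ e s).sub (hasDerivAt_phiB_line hκ Y₂ hb₂0 x₁ e s)
    have hzero : ∀ s ∈ Set.Icc (0 : ℝ) 1, H s = 0 →
        pt (x₁ + s • e) (phiB κ Y b (x₁ + s • e)) ∈ cyl Ω τ₀ ∧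
        H' s = Θ (pt (x₁ + s • e) (phiB κ Y b (x₁ + s • e))) := by
      intro s hs h0
      have h0' : phiB κ Y b (x₁ + s • e) = phiB κ Y₂ b₂ (x₁ + s • e) := sub_eq_zero.1 h0
      refine ⟨⟨mem s hs, ?_, ?_⟩, ?_⟩
      -- The meeting point stays in the cylinder: concavity keeps its height nonnegative, and the
      -- support inequality keeps it below `u ≤ τ₀`.
      · have hcv := phiB_concave hκ Y b x₁ e hs.1 hs.2
        rw [hxe, heq] at hcv
        have p1 := mul_nonneg (sub_nonneg.2 hs.2) (hu.pos x₁ hx₁).le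
        have p2 := mul_nonneg hs.1 ((hu.pos x hx).trans hlt).le
        rw [pt_snd]
        linarith
      · rw [pt_snd, h0']
        exact (hle₂ _ (mem s hs)).trans (hu.le_tau _ (mem s hs))
      · simp only [hH', hΘ, inner_sub_left, ← h0']
    have H0 : 0 ≤ H 0 := by
      simp only [hH, zero_smul, add_zero]; linarith
    have H2 : H s₂ ≤ 0 := by
      simp only [hH]; linarith
    have H1 : 0 < H 1 := by
      simp only [hH, one_smul, hxe]; linarith
    by_cases hpos : ∀ X ∈ cyl Ω τ₀, 0 < Θ X
    · have := pos_of_deriv_pos_at_zeros hs20 hd (fun s hs h0 => by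
        obtain ⟨m, e'⟩ := hzero s ⟨hs.1, hs.2.trans hs21.le⟩ h0
        rw [e']; exact hpos _ m) H0
      linarith
    · push Not at hpos
      obtain ⟨X, hX, hX0⟩ := hpos
      have hneg : ∀ X' ∈ cyl Ω τ₀, Θ X' < 0 := by
        intro X' hX'
        by_contra hc
        obtain ⟨X'', hX'', h0⟩ := h.isPreconnected_cyl.intermediate_value hX hX' hΘc
          (Set.mem_Icc.2 ⟨hX0, not_lt.1 hc⟩)
        exact hΘ0 X'' hX'' h0
      have := pos_of_deriv_pos_at_zeros (H := fun s => -H s) (H' := fun s => -H' s) hs21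
        (fun s => (hd s).neg) (fun s hs h0 => by
          obtain ⟨m, e'⟩ := hzero s ⟨hs20.le.trans hs.1, hs.2⟩ (neg_eq_zero.1 h0)
          rw [e', neg_pos]; exact hneg _ m) (neg_nonneg.2 H2)
      linarith

end OneDimension

/-! ### The maximum principle on the source and the inclusion in the normal map -/

section Main

variable {n : ℕ} {κ τ₀ τ₁ ω : ℝ} {Ω : Set (Src n)} {target : Set (Pt n)}

/-- The factor lost when the quadratic gain is propagated to the whole source. -/
noncomputable def propagation (κ τ₀ τ₁ ω D : ℝ) : ℝ :=
  gainConst (beta κ τ₀ τ₁ / (κ ^ 2 - 1)) (κ ^ 2 - 1) (sqrtBound κ τ₁ ω D) * ((κ ^ 2 - 1) / 2)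

theorem Config.sqrtBound_pos (h : Config κ τ₀ τ₁ ω Ω target) {x : Src n} (hx : x ∈ Ω) {Y : Pt n}
    (hY : Y ∈ target) : 0 < sqrtBound κ τ₁ ω (bigDelta Ω target) := by
  have hk := kpos h.one_lt_kappa
  have hβ := h.beta_pos
  have hZ : pt x 0 ∈ cyl Ω τ₀ := ⟨hx, le_rfl, h.tau_zero_pos.le⟩
  exact (by positivity : 0 < beta κ τ₀ τ₁ / (κ ^ 2 - 1)).trans_le
    ((h.le_norm_hv_c hZ hY x).trans (h.norm_hv_c_le hZ hY hx))

theorem Config.propagation_pos (h : Config κ τ₀ τ₁ ω Ω target) {x : Src n} (hx : x ∈ Ω) {Y : Pt n}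
    (hY : Y ∈ target) : 0 < propagation κ τ₀ τ₁ ω (bigDelta Ω target) := by
  have hk := kpos h.one_lt_kappa
  have hβ := h.beta_pos
  have hs := h.sqrtBound_pos hx hY
  unfold propagation gainConst
  positivity

/-- The maximum principle for the middle half of a refractor segment: with the original range of
`x` in every dimension, and on all of the source in dimension at least two. -/
theorem Config.max_principle (h : Config κ τ₀ τ₁ ω Ω target) {Z : Pt n} (hZ : Z ∈ cyl Ω τ₀)
    {c₁ R : ℝ} (hc₁ : 0 < c₁) (hR : 0 < R)
    (hreg : ∀ Ybar ∈ target, ∀ Yhat ∈ target, ∀ t ∈ Set.Icc (1 / 4 : ℝ) (3 / 4),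
      ∃ Y ∈ segPts κ target Z Ybar Yhat t, ∀ x ∈ Ω, ‖x - Z.fst‖ ≤ R →
        phi κ x Y Z ≤ max (phi κ x Ybar Z) (phi κ x Yhat Z)
          - c₁ * ‖Ybar - Yhat‖ ^ 2 * ‖x - Z.fst‖ ^ 2)
    {Ybar Yhat Yt : Pt n} (hYb : Ybar ∈ target) (hYh : Yhat ∈ target)
    (hYt : Yt ∈ midHalf κ target Z Ybar Yhat) {x : Src n} (hx : x ∈ Ω)
    (hcase : ‖x - Z.fst‖ ≤ R ∨ 2 ≤ n) :
    phi κ x Yt Z ≤ max (phi κ x Ybar Z) (phi κ x Yhat Z)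
      - min c₁ (propagation κ τ₀ τ₁ ω (bigDelta Ω target) * c₁)
        * ‖Ybar - Yhat‖ ^ 2 * ‖x - Z.fst‖ ^ 2 := by
  simp only [midHalf, Set.mem_iUnion] at hYt
  obtain ⟨t, ht, hYt⟩ := hYt
  obtain ⟨Y, hY, hloc⟩ := hreg Ybar hYb Yhat hYh t ht
  obtain rfl := h.segPts_subsingleton hZ Ybar Yhat t hY hYt
  have ht0 : 0 ≤ t := by linarith [ht.1]
  have ht1 : t ≤ 1 := by linarith [ht.2]
  have hs := h.slope_segPts hZ hYb hYh ht0 ht1 hY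
  rcases hcase with hcase | hn
  · refine (hloc x hx hcase).trans ?_
    gcongr
    exact min_le_left _ _
  · by_cases hne : Ybar = Yhat
    · subst hne
      have : Y = Ybar := h.slope_inj hZ hY.1 hYb (by rw [hs, vAt]; module)
      simp [this]
    · have hconc := h.concavity_of_local hn hZ hYb hYh hY.1 hne hs
        (γ := c₁ * ‖Ybar - Yhat‖ ^ 2) (by positivity) hR hloc
      have hk := kpos h.one_lt_kappa
      refine (h.max_principle_of_concavity hZ hYb hYh hY.1 ht0 ht1 hs (by positivity) hconc
        hx).trans ?_
      have hle : min c₁ (propagation κ τ₀ τ₁ ω (bigDelta Ω target) * c₁)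
          * ‖Ybar - Yhat‖ ^ 2 * ‖x - Z.fst‖ ^ 2
          ≤ propagation κ τ₀ τ₁ ω (bigDelta Ω target) * c₁
          * ‖Ybar - Yhat‖ ^ 2 * ‖x - Z.fst‖ ^ 2 := by
        gcongr
        exact min_le_right _ _
      unfold propagation at hle ⊢
      linarith

/-- If a hyperboloid through a point of the graph lies strictly below the refractor at distance at
least `r` from that point, then its focus belongs to the normal map of a point at distance at most
`r`. -/
theorem IsRefractor.exists_mem_normalMap (h : Config κ τ₀ τ₁ ω Ω target) (hn : 1 ≤ n)
    {u : Src n → ℝ} (hu : IsRefractor κ τ₀ Ω target u) {x₀ : Src n} {r R : ℝ} (hr : 0 ≤ r)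
    (hrR : r < R) (hball : Metric.closedBall x₀ r ⊆ Ω) {Y : Pt n} (hY : Y ∈ target)
    (hlow : ∀ x ∈ Ω, r ≤ ‖x - x₀‖ → (‖x - x₀‖ < R ∨ 2 ≤ n) →
      phi κ x Y (pt x₀ (u x₀)) ≤ u x) :
    ∃ x ∈ Metric.closedBall x₀ r, Y ∈ normalMap κ Ω target u x := by
  have hκ := h.one_lt_kappa
  have hx₀ : x₀ ∈ Ω := hball (Metric.mem_closedBall_self hr)
  have hcont : ContinuousOn (fun x => c κ (pt x (u x)) Y) (Metric.closedBall x₀ r) := by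
    have h1 : ContinuousOn u (Metric.closedBall x₀ r) := (hu.continuousOn h).mono hball
    have h2 : ContinuousOn (fun x => pt x (u x)) (Metric.closedBall x₀ r) :=
      continuous_pt.comp_continuousOn (continuousOn_id.prodMk h1)
    have h3 : ContinuousOn (fun x => ‖pt x (u x) - Y‖) (Metric.closedBall x₀ r) :=
      (h2.sub continuousOn_const).norm
    unfold c
    simp only [pt_snd]
    fun_prop
  -- A larger parameter lowers the hyperboloid. The largest `c` over the ball is the first at which
  -- it lies below `u` on the whole ball, with contact at `x₁`; outside, it lies below the
  -- hyperboloid through the graph point over `x₀`.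
  obtain ⟨x₁, hx₁, hmax⟩ := (isCompact_closedBall x₀ r).exists_isMaxOn
    ⟨x₀, Metric.mem_closedBall_self hr⟩ hcont
  have hx₁Ω := hball hx₁
  have hpos : ∀ x ∈ Ω, 0 < c κ (pt x (u x)) Y := fun x hx => h.c_pos (hu.mem_cyl hx) hY
  have hloc : ∀ x ∈ Ω, (‖x - x₀‖ < R ∨ 2 ≤ n) → phiB κ Y (c κ (pt x₁ (u x₁)) Y) x ≤ u x := by
    intro x hx hc
    rcases le_total r ‖x - x₀‖ with hrx | hrx
    · refine le_trans ?_ (hlow x hx hrx hc)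
      exact phiB_anti hκ Y (hpos _ hx₀).le (hmax (Metric.mem_closedBall_self hr)) x
    · have h1 := phiB_anti hκ Y (hpos _ hx).le (hmax (mem_closedBall_iff_norm.2 hrx)) x
      exact h1.trans_eq (phi_pt_self hκ Y x (u x))
  refine ⟨x₁, hx₁, hY, ?_⟩
  rcases hn.eq_or_lt with rfl | hn2
  · have hd : ‖x₁ - x₀‖ < R := (mem_closedBall_iff_norm.1 hx₁).trans_lt hrR
    intro x hx
    refine hu.le_of_local_support h hx₁Ω hY (hpos _ hx₁Ω) (phi_pt_self hκ Y x₁ (u x₁))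
      (sub_pos.2 hd) (fun w hw hwd => hloc w hw (Or.inl ?_)) hx
    have : ‖w - x₀‖ ≤ ‖w - x₁‖ + ‖x₁ - x₀‖ := norm_sub_le_norm_sub_add_norm_sub _ _ _
    linarith
  · exact fun x hx => hloc x hx (Or.inr hn2)

/-- The quadratic lower bound is positive away from `x₀`. -/
theorem lower_bound_pos {C C₁ a s r m : ℝ} (hC : 0 < C) (hC₁ : 0 < C₁) (ha : 0 < a) (hs : 0 < s)
    (hm : m ≤ a ^ 2 * s) (hr : (1 + 2 * C / C₁) * s ≤ r) :
    0 ≤ -C * a * (a * s ^ 2) - C * m * r + C₁ * a ^ 2 * r ^ 2 := by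
  have h0 : 0 < 2 * C / C₁ := by positivity
  have hsr : s ≤ r := by nlinarith
  have hr0 : 0 < r := hs.trans_le hsr
  have h1 : (C₁ + 2 * C) * s ≤ C₁ * r := by
    have := mul_le_mul_of_nonneg_left hr hC₁.le
    have e : C₁ * ((1 + 2 * C / C₁) * s) = (C₁ + 2 * C) * s := by field_simp
    linarith
  have h2 : C * m * r ≤ C * (a ^ 2 * s) * r := by gcongr
  have h3 : (C₁ + 2 * C) * s * r ≤ C₁ * r * r := by gcongr
  have h4 : C * s * s ≤ C * s * r := by gcongr
  have h5 : 0 ≤ C₁ * s * r := by positivity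
  have h6 : 0 ≤ a ^ 2 * (C₁ * r * r - C * s * s - C * s * r) := by
    apply mul_nonneg (by positivity); linarith
  linarith

/-- In terms of `s = √(d / a)` one has `d = a s²`, `μ = a² s` and `η = M s`. The quadratic term wins
from radius `(1 + 2C / C₁) s = M s / 2` on; the factor two in `M` puts that closed ball inside the
open ball of radius `η`. The lower bound on `a / d` says that `M s` is at most `δ / 2` and `R / 2`.
-/
theorem IsRefractor.thickening_subset (h : Config κ τ₀ τ₁ ω Ω target) (hn : 1 ≤ n)
    {u : Src n → ℝ} (hu : IsRefractor κ τ₀ Ω target u) {xs : Src n} {δ C C₁ R : ℝ} (hδ : 0 < δ)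
    (hC : 0 < C) (hC₁ : 0 < C₁) (hR : 0 < R) (hball : Metric.ball xs δ ⊆ Ω) {x₀ : Src n}
    (hx₀ : x₀ ∈ Metric.ball xs (δ / 2)) {a d M : ℝ} (hM : M = 2 + 4 * C / C₁) (hd : 0 ≤ d)
    (hle : max 1 (max ((2 * M / δ) ^ 2) ((2 * M / R) ^ 2)) * d ≤ a) {S : Set (Pt n)}
    (hlow : ∀ Yt ∈ S, ∀ Y ∈ target, ∀ x ∈ Ω, (‖x - x₀‖ < R ∨ 2 ≤ n) →
      -C * a * d - C * ‖Yt - Y‖ * ‖x - x₀‖ + C₁ * a ^ 2 * ‖x - x₀‖ ^ 2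
        ≤ u x - phi κ x Y (pt x₀ (u x₀))) :
    Metric.thickening (a ^ (3 / 2 : ℝ) * d ^ (1 / 2 : ℝ)) S ∩ target
      ⊆ ⋃ x ∈ Metric.ball x₀ (M * (d / a) ^ (1 / 2 : ℝ)), normalMap κ Ω target u x := by
  rcases hd.eq_or_lt with h0 | h0
  -- For `d = 0` the open thickening has radius zero and is empty.
  · rw [← h0, Real.zero_rpow (by norm_num), mul_zero, Metric.thickening_of_nonpos le_rfl,
      Set.empty_inter]
    exact Set.empty_subset _
  have ha : 0 < a := by
    have : 1 * d ≤ max 1 (max ((2 * M / δ) ^ 2) ((2 * M / R) ^ 2)) * d := by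
      gcongr; exact le_max_left _ _
    linarith
  have hM0 : 0 < M := by rw [hM]; positivity
  set s := (d / a) ^ (1 / 2 : ℝ) with hs
  have hs0 : 0 < s := by positivity
  have hs2 : s ^ 2 = d / a := by
    rw [hs, ← Real.rpow_natCast, ← Real.rpow_mul (by positivity)]; norm_num
  have hd_eq : d = a * s ^ 2 := by rw [hs2]; field_simp
  have hμ : a ^ (3 / 2 : ℝ) * d ^ (1 / 2 : ℝ) = a ^ 2 * s := by
    rw [hs, Real.div_rpow h0.le ha.le, ← mul_div_assoc, eq_div_iff (by positivity),
      mul_right_comm, ← Real.rpow_add ha]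
    norm_num
  have small : ∀ ρ : ℝ, 0 < ρ → (2 * M / ρ) ^ 2 ≤ max 1 (max ((2 * M / δ) ^ 2) ((2 * M / R) ^ 2)) →
      M * s ≤ ρ / 2 := by
    intro ρ hρ hmax
    have h1 : (2 * M / ρ) ^ 2 * (a * s ^ 2) ≤ a := by
      rw [← hd_eq]; exact (mul_le_mul_of_nonneg_right hmax h0.le).trans hle
    have h2 : (2 * M / ρ * s) ^ 2 ≤ 1 ^ 2 := by
      rw [mul_pow]
      have : a * ((2 * M / ρ) ^ 2 * s ^ 2) ≤ a * 1 ^ 2 := by linarith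
      exact le_of_mul_le_mul_left this ha
    have h3 := (abs_le_of_sq_le_sq' h2 zero_le_one).2
    have e : M * s = ρ / 2 * (2 * M / ρ * s) := by field_simp
    rw [e]
    exact mul_le_of_le_one_right (by positivity) h3
  have hη1 := small δ hδ ((le_max_left _ _).trans (le_max_right _ _))
  have hη2 := small R hR ((le_max_right _ _).trans (le_max_right _ _))
  have hMs : 0 < M * s := by positivity
  rintro Y ⟨hYth, hY⟩
  obtain ⟨Yt, hYt, hdist⟩ := Metric.mem_thickening_iff.1 hYth
  rw [hμ, dist_comm, dist_eq_norm] at hdist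
  have hcb : Metric.closedBall x₀ (M * s / 2) ⊆ Ω := by
    intro w hw
    apply hball
    rw [Metric.mem_ball] at hx₀ ⊢
    rw [Metric.mem_closedBall] at hw
    linarith [dist_triangle w x₀ xs]
  obtain ⟨x₁, hx₁, hmem⟩ := hu.exists_mem_normalMap h hn (x₀ := x₀) (r := M * s / 2) (R := R)
    (by positivity) (by linarith) hcb hY (fun x hx hrx hc => by
      have h1 := hlow Yt hYt Y hY x hx hc
      have h2 := lower_bound_pos (C := C) (C₁ := C₁) (a := a) (s := s) (r := ‖x - x₀‖) hC hC₁ ha hs0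
        hdist.le (le_trans (le_of_eq (by rw [hM]; ring)) hrx)
      rw [← hd_eq] at h2
      linarith)
  refine Set.mem_biUnion (Metric.mem_ball.2 ?_) hmem
  linarith [Metric.mem_closedBall.1 hx₁]

end Main

end ParallelRefractor

theorem mainTheorem2 :
    ∃ M : ℝ → ℝ → ℝ, (∀ C C₁ : ℝ, 0 < C → 0 < C₁ → 0 < M C C₁) ∧
      ∀ (n : ℕ), 1 ≤ n → ∀ (κ τ₀ τ₁ ω : ℝ) (Ω : Set (ParallelRefractor.Src n))
        (target : Set (ParallelRefractor.Pt n)),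
        ParallelRefractor.Config κ τ₀ τ₁ ω Ω target →
        ∃ C : ℝ, 0 < C ∧
          ∀ Xs ∈ ParallelRefractor.cyl Ω τ₀, ParallelRefractor.RegularFrom κ τ₀ Ω target Xs →
            ∃ δ C₁ C₂ : ℝ, 0 < δ ∧ 0 < C₁ ∧ 0 < C₂ ∧ Metric.ball Xs.fst δ ⊆ Ω ∧
              ∀ u : ParallelRefractor.Src n → ℝ,
                ParallelRefractor.IsRefractor κ τ₀ Ω target u → u Xs.fst = Xs.snd →
                ParallelRefractor.QuadraticBound κ Ω target u Xs.fst δ C C₁ C₂ ∧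
                ∀ xbar ∈ Metric.ball Xs.fst (δ / 2), ∀ xhat ∈ Metric.ball Xs.fst (δ / 2),
                  ∀ Ybar ∈ ParallelRefractor.normalMap κ Ω target u xbar,
                  ∀ Yhat ∈ ParallelRefractor.normalMap κ Ω target u xhat,
                    max 1 (max ((2 * M C C₁ / δ) ^ 2) ((2 * M C C₁ / C₂) ^ 2)) * ‖xbar - xhat‖
                        ≤ ‖Ybar - Yhat‖ →
                      ∃ x₀ ∈ segment ℝ xbar xhat,
                        Metric.thickening
                            (‖Ybar - Yhat‖ ^ (3 / 2 : ℝ) * ‖xbar - xhat‖ ^ (1 / 2 : ℝ))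
                            (ParallelRefractor.midHalf κ target
                              (ParallelRefractor.pt x₀ (u x₀)) Ybar Yhat) ∩ target
                          ⊆ ⋃ x ∈ Metric.ball x₀
                              (M C C₁ * (‖xbar - xhat‖ / ‖Ybar - Yhat‖) ^ (1 / 2 : ℝ)),
                              ParallelRefractor.normalMap κ Ω target u x := by
  open ParallelRefractor in
  refine ⟨fun C C₁ => 2 + 4 * C / C₁, fun C C₁ hC hC₁ => by positivity,
    fun n hn κ τ₀ τ₁ ω Ω target h => ?_⟩
  have hκ := h.one_lt_kappa
  have hβ := h.beta_pos
  have hC : 0 < boundConst κ (beta κ τ₀ τ₁) := by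
    have := mixedConst_pos hκ hβ
    have : 0 < (κ + 1) / (κ - 1) := div_pos (by linarith) (by linarith)
    unfold boundConst
    positivity
  refine ⟨boundConst κ (beta κ τ₀ τ₁), hC, fun Xs hXs hreg => ?_⟩
  obtain ⟨U, hU, c₁, hc₁, R, hR, hreg⟩ := hreg
  obtain ⟨ε, hε, hεU⟩ := Metric.mem_nhds_iff.1 hU
  obtain ⟨δ₀, hδ₀, hδ₀Ω⟩ := Metric.isOpen_iff.1 h.isOpen_source Xs.fst hXs.1
  have hs : 0 < Real.sqrt (κ ^ 2 - 1) := Real.sqrt_pos.2 (kpos hκ)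
  -- Since `u` is Lipschitz with constant `1 / √(κ² - 1)`, this radius keeps `(x₀, u x₀)` within `ε`
  -- of `Xs`, uniformly in `u`.
  set δ := min δ₀ (ε / (1 + 1 / Real.sqrt (κ ^ 2 - 1))) with hδdef
  have hδ : 0 < δ := lt_min hδ₀ (by positivity)
  have hball : Metric.ball Xs.fst δ ⊆ Ω := (Metric.ball_subset_ball (min_le_left _ _)).trans hδ₀Ω
  -- An empty target admits no refractor; positivity of `propagation` is proved using a point of the
  -- target.
  rcases target.eq_empty_or_nonempty with hT | ⟨Y₀, hY₀⟩
  · refine ⟨δ, 1, 1, hδ, one_pos, one_pos, hball, fun u hu _ => ?_⟩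
    obtain ⟨Y, hY, -⟩ := hu.support _ hXs.1
    rw [hT] at hY
    exact hY.elim
  have hp := h.propagation_pos hXs.1 hY₀
  set C₁ := min c₁ (propagation κ τ₀ τ₁ ω (bigDelta Ω target) * c₁) with hC₁def
  have hC₁ : 0 < C₁ := lt_min hc₁ (by positivity)
  refine ⟨δ, C₁, R, hδ, hC₁, hR, hball, fun u hu hus => ?_⟩
  -- One bound serves both parts: near `x₀` in every dimension, and on all of `Ω` when `2 ≤ n`.
  have key : ∀ xbar ∈ Metric.ball Xs.fst δ, ∀ xhat ∈ Metric.ball Xs.fst δ,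
      ∀ Ybar ∈ normalMap κ Ω target u xbar, ∀ Yhat ∈ normalMap κ Ω target u xhat,
      ‖xbar - xhat‖ ≤ ‖Ybar - Yhat‖ → ∃ x₀ ∈ segment ℝ xbar xhat,
        ∀ Yt ∈ midHalf κ target (pt x₀ (u x₀)) Ybar Yhat, ∀ Y ∈ target,
          ∀ x ∈ Ω, (‖x - x₀‖ < R ∨ 2 ≤ n) →
            -boundConst κ (beta κ τ₀ τ₁) * ‖Ybar - Yhat‖ * ‖xbar - xhat‖
                - boundConst κ (beta κ τ₀ τ₁) * ‖Yt - Y‖ * ‖x - x₀‖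
                + C₁ * ‖Ybar - Yhat‖ ^ 2 * ‖x - x₀‖ ^ 2
              ≤ u x - phi κ x Y (pt x₀ (u x₀)) := by
    intro xbar hxb xhat hxh Ybar hYb Yhat hYh hle
    obtain ⟨x₀, hx₀, hlow⟩ := hu.exists_lower_bound h (hball hxb) (hball hxh) hYb hYh hle
    refine ⟨x₀, hx₀, fun Yt hYt Y hY x hx hc => ?_⟩
    have hx₀δ := (convex_ball Xs.fst δ).segment_subset hxb hxh hx₀
    have hZ : pt x₀ (u x₀) ∈ cyl Ω τ₀ := hu.mem_cyl (hball hx₀δ)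
    have hZU : pt x₀ (u x₀) ∈ U := by
      apply hεU
      have h1 : ‖pt x₀ (u x₀) - Xs‖ ≤ ‖x₀ - Xs.fst‖ + |u x₀ - u Xs.fst| := by
        apply abs_le_of_sq_le_sq' _ (by positivity) |>.2
        rw [norm_sq_pt, WithLp.sub_fst, WithLp.sub_snd, pt_fst, pt_snd, ← hus, add_sq, sq_abs]
        have : 0 ≤ 2 * ‖x₀ - Xs.fst‖ * |u x₀ - u Xs.fst| := by positivity
        linarith
      have h2 := hu.abs_sub_le h (hball hx₀δ) hXs.1
      have h3 : ‖x₀ - Xs.fst‖ < ε / (1 + 1 / Real.sqrt (κ ^ 2 - 1)) :=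
        (mem_ball_iff_norm.1 hx₀δ).trans_le (min_le_right _ _)
      rw [lt_div_iff₀ (by positivity)] at h3
      rw [mem_ball_iff_norm]
      calc ‖pt x₀ (u x₀) - Xs‖ ≤ ‖x₀ - Xs.fst‖ + ‖x₀ - Xs.fst‖ / Real.sqrt (κ ^ 2 - 1) := by linarith
        _ = ‖x₀ - Xs.fst‖ * (1 + 1 / Real.sqrt (κ ^ 2 - 1)) := by ring
        _ < ε := h3
    have hYtT : Yt ∈ target := by
      simp only [midHalf, Set.mem_iUnion] at hYt
      obtain ⟨t, -, hYt⟩ := hYt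
      exact hYt.1
    exact hlow Yt hYtT Y hY x hx _ (h.max_principle hZ hc₁ hR
      (fun Y₁ h₁ Y₂ h₂ t ht => hreg Y₁ h₁ Y₂ h₂ _ ⟨hZU, hZ⟩ t ht) hYb.1 hYh.1 hYt hx
      (hc.imp le_of_lt id))
  refine ⟨fun xbar hxb xhat hxh Ybar hYb Yhat hYh hle => ?_,
    fun xbar hxb xhat hxh Ybar hYb Yhat hYh hle => ?_⟩
  · obtain ⟨x₀, hx₀, hlow⟩ := key xbar hxb xhat hxh Ybar hYb Yhat hYh hle
    exact ⟨x₀, hx₀, fun Yt hYt Y hY x hx =>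
      hlow Yt hYt Y hY x hx.1 (Or.inl (mem_ball_iff_norm.1 hx.2))⟩
  · have hsub : Metric.ball Xs.fst (δ / 2) ⊆ Metric.ball Xs.fst δ :=
      Metric.ball_subset_ball (by linarith)
    have hle1 : ‖xbar - xhat‖ ≤ ‖Ybar - Yhat‖ :=
      (le_mul_of_one_le_left (norm_nonneg _) (le_max_left _ _)).trans hle
    obtain ⟨x₀, hx₀, hlow⟩ := key xbar (hsub hxb) xhat (hsub hxh) Ybar hYb Yhat hYh hle1
    exact ⟨x₀, hx₀, hu.thickening_subset h hn hδ hC hC₁ hR hball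
      ((convex_ball _ _).segment_subset hxb hxh hx₀) rfl (norm_nonneg _) hle hlow⟩
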